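/- Let $\lambda$ be a partition (Young diagrams in English notation, rows numbered $1,2,\dots$ from top to bottom). Let ${\sf S}(\lambda)$ be the set of semistandard set-valued tableaux of shape $\lambda$: fillings $F$ of the boxes of $\lambda$ by finite nonempty sets of positive integers such that $\max A\le \min B$ whenever the box containing $A$ is to the left of the box containing $B$ in the same row, and $\max A<\min B$ whenever the box containing $A$ is above the box containing $B$ in the same column. Let ${\sf L}(\lambda)$ be the set of pairs $(T,U)$ such that, for some partition $\mu\supseteq\lambda$, $T$ is a filling of $\mu/\lambda$ that is strictly increasing along rows and down columns and whose entries in row $i$ lie in $[1,i-1]$, and $U$ is a semistandard tableau of shape $\mu$ with positive integer entries. Define ${\tt uncrowd}$ on $F\in{\sf S}(\lambda)$ as follows. Begin with $U=F$ and $T$ the empty filling of $\lambda/\lambda$. Read the boxes of $F$ row by row from bottom to top, and in each row from right to left. While the current box, say in row $i$, contains more than one number, remove the largest number from it and RSK-insert that number into the tableau formed by the rows of $U$ below row $i$, starting in row $i+1$; this creates a new box of $U$, in some row $k$, and $k-i$ is recorded in the corresponding box of $T$. The final pair is ${\tt uncrowd}(F)=(T,U)$. Define ${\tt crowd}$ on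 $(T,U)\in{\sf L}(\lambda)$ as follows. Let $\tilde T$ be obtained from $T$ by replacing each entry $t$ in row $k$ by $k-t$. While $\tilde T$ is not empty, let $i$ be its minimal entry and choose the lowest box of $\tilde T$ with entry $i$. Perform reverse RSK in $U$ starting from that box, up to the point where a number $x$ is bumped out of row $i+1$; put $x$ into the box $b$ of row $i$ of $U$ such that $\max(b)<x\le\min(b')$ for the box $b'$ to the right of $b$ (only $\max(b)<x$ is required if $b$ is the last box of its row). Remove the emptied box from $U$ and the corresponding box from $\tilde T$. The final filling $U$ is ${\tt crowd}(T,U)$. Theorem. For every partition $\lambda$, ${\tt uncrowd}$ is a bijection from ${\sf S}(\lambda)$ onto ${\sf L}(\lambda)$, ${\tt crowd}$ is a bijection from ${\sf L}(\lambda)$ onto ${\sf S}(\lambda)$, and the two maps are inverse to each other. They preserve weights: if ${\tt uncrowd}(F)=(T,U)$, then for every $v$ the number of boxes of $F$ containing $v$ equals the number of boxes of $U$ with entry $v$ (that is, $x^F=x^U$), and $|F|-|\lambda|=|T|$, where $|F|$ is the total number of entries of $F$ and $|T|=|\mu/\lambda|$ is the number of boxes of $T$. -/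

import Mathlib

namespace Crowding

/-! Fillings of Young diagrams are given by their list of rows, from top to bottom, each row being
the list of its boxes from left to right (English notation). Rows and columns are numbered from `0`,
so the `i`-th row of the usual numbering has index `i - 1`. -/

/-- The content of the box in row `i` and column `j`; `0` (for a set-valued filling: `∅`) if there
is no such box. -/
def entry {α : Type*} (d : α) (F : List (List α)) (i j : ℕ) : α := (F.getD i []).getD j d

/-- The rows of `F` have the lengths of the (nonempty) rows of `μ`. -/
def HasShape {α : Type*} (μ : YoungDiagram) (F : List (List α)) : Prop :=
  F.map List.length = μ.rowLens

/-- Semistandard set-valued tableaux of shape `lam`: the boxes hold finite nonempty sets of positive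
integers, `max A ≤ min B` if `A` is to the left of `B` in a row, and `max A < min B` if `A` is
above `B` in a column. -/
structure IsSetValuedTableau (lam : YoungDiagram) (F : List (List (Finset ℕ))) : Prop where
  shape : HasShape lam F
  nonempty : ∀ i j, (i, j) ∈ lam → (entry ∅ F i j).Nonempty
  pos : ∀ i j, ∀ x ∈ entry ∅ F i j, 0 < x
  row_weak : ∀ i j₁ j₂, j₁ < j₂ → (i, j₂) ∈ lam →
    ∀ x ∈ entry ∅ F i j₁, ∀ y ∈ entry ∅ F i j₂, x ≤ y
  col_strict : ∀ i₁ i₂ j, i₁ < i₂ → (i₂, j) ∈ lam →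
    ∀ x ∈ entry ∅ F i₁ j, ∀ y ∈ entry ∅ F i₂ j, x < y

/-- The set `S(lam)`. -/
def S (lam : YoungDiagram) : Set (List (List (Finset ℕ))) := {F | IsSetValuedTableau lam F}

/-- `U` is a semistandard tableau of shape `μ` with positive entries. -/
structure IsSemistandard (μ : YoungDiagram) (U : List (List ℕ)) : Prop where
  shape : HasShape μ U
  pos : ∀ i j, (i, j) ∈ μ → 0 < entry 0 U i j
  semistandard : ∃ V : SemistandardYoungTableau μ, ∀ i j, V i j = entry 0 U i j

/-- `T` is a row- and column-strict filling of the skew shape `μ / lam` whose entries in the row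
with index `i` (the `(i + 1)`-st row) lie between `1` and `i`. The boxes of `lam`, which are not
filled, are kept in `T` and marked by `0`. -/
structure IsStrictSkew (lam μ : YoungDiagram) (T : List (List ℕ)) : Prop where
  le : lam ≤ μ
  shape : HasShape μ T
  unfilled : ∀ i j, (i, j) ∈ lam → entry 0 T i j = 0
  range : ∀ i j, (i, j) ∈ μ → (i, j) ∉ lam → 1 ≤ entry 0 T i j ∧ entry 0 T i j ≤ i
  row_strict : ∀ i j₁ j₂, j₁ < j₂ → (i, j₁) ∉ lam → (i, j₂) ∈ μ →
    entry 0 T i j₁ < entry 0 T i j₂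
  col_strict : ∀ i₁ i₂ j, i₁ < i₂ → (i₁, j) ∉ lam → (i₂, j) ∈ μ →
    entry 0 T i₁ j < entry 0 T i₂ j

/-- The set `L(lam)` of Lenart's pairs `(T, U)`. -/
def L (lam : YoungDiagram) : Set (List (List ℕ) × List (List ℕ)) :=
  {p | ∃ μ : YoungDiagram, IsStrictSkew lam μ p.1 ∧ IsSemistandard μ p.2}

/-! ### RSK row insertion and its inverse -/

/-- Insert `x` into a row: it replaces the leftmost entry greater than `x`, which is bumped
(returned), or is appended at the end of the row if there is no such entry. -/
def rowInsert (x : ℕ) : List ℕ → List ℕ × Option ℕ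
  | [] => ([x], none)
  | y :: ys => if x < y then (x :: ys, some y) else (y :: (rowInsert x ys).1, (rowInsert x ys).2)

/-- RSK-insert `x` into the first row of a tableau. Returns the new tableau and the index of the row
that has a new box. -/
def rskInsert (x : ℕ) : List (List ℕ) → List (List ℕ) × ℕ
  | [] => ([[x]], 0)
  | R :: Rs =>
    match rowInsert x R with
    | (R', none) => (R' :: Rs, 0)
    | (R', some y) => (R' :: (rskInsert y Rs).1, (rskInsert y Rs).2 + 1)

/-- Reverse-bump `y` into a row: it replaces the rightmost entry less than `y`, which is
returned. -/
def rowDelete (y : ℕ) : List ℕ → List ℕ × ℕ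
  | [] => ([], 0)
  | z :: zs =>
    if ∃ w ∈ zs, w < y then (z :: (rowDelete y zs).1, (rowDelete y zs).2) else (y :: zs, z)

/-- Remove the last box of the row with index `k`; a row that has become empty disappears. -/
def removeBox : ℕ → List (List ℕ) → List (List ℕ)
  | _, [] => []
  | 0, R :: Rs => if R.length ≤ 1 then Rs else R.dropLast :: Rs
  | k + 1, R :: Rs => R :: removeBox k Rs

/-- Reverse RSK: remove the last box of the row with index `k`, reverse-bump its entry into the row
above, and so on. Returns the new tableau and the entry that is bumped out of the first row. -/
def rskDelete : ℕ → List (List ℕ) → List (List ℕ) × ℕ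
  | _, [] => ([], 0)
  | 0, R :: Rs => (removeBox 0 (R :: Rs), R.getLastD 0)
  | k + 1, R :: Rs =>
    ((rowDelete (rskDelete k Rs).2 R).1 :: (rskDelete k Rs).1, (rowDelete (rskDelete k Rs).2 R).2)

/-! ### The map `uncrowd` -/

/-- Put a new box with entry `a` at the end of the row with index `k`. -/
def appendBox (a : ℕ) : ℕ → List (List ℕ) → List (List ℕ)
  | 0, [] => [[a]]
  | 0, R :: Rs => (R ++ [a]) :: Rs
  | k + 1, [] => [] :: appendBox a k []
  | k + 1, R :: Rs => R :: appendBox a k Rs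

/-- RSK-insert a number `x` that was removed from some row into the tableau `U` formed by the rows
below it, and record in `T`, in the place of the new box, how many rows below the original row of
`x` that box is. -/
def uncrowdNumber (p : List (List ℕ) × List (List ℕ)) (x : ℕ) : List (List ℕ) × List (List ℕ) :=
  (appendBox ((rskInsert x p.2).2 + 1) (rskInsert x p.2).2 p.1, (rskInsert x p.2).1)

/-- The numbers other than its minimum in a box, from the largest to the smallest. -/
def extras (B : Finset ℕ) : List ℕ := (B.sort (· ≥ ·)).dropLast

/-- The number that stays in a box: its minimum. -/
def boxMin (B : Finset ℕ) : ℕ := (B.sort (· ≥ ·)).getLastD 0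

/-- Uncrowd the boxes of `F` from bottom to top and right to left, in each box from the largest
number on until only the minimum is left: when the row `R` is read, the rows `Rs` below it have been
uncrowded already; the extra numbers of `R` are inserted into the result, one after the other. -/
def uncrowd : List (List (Finset ℕ)) → List (List ℕ) × List (List ℕ)
  | [] => ([], [])
  | R :: Rs =>
    let p := (R.reverse.flatMap extras).foldl uncrowdNumber (uncrowd Rs)
    (R.map (fun _ => 0) :: p.1, R.map boxMin :: p.2)

/-! ### The map `crowd` -/

/-- Put `x` into the box `B` of a set-valued row with `max B < x ≤ min C` for the box `C` to the
right of `B` (`max B < x` if `B` is the last box). -/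
def crowdNumber (x : ℕ) : List (Finset ℕ) → List (Finset ℕ)
  | [] => []
  | B :: Bs =>
    if (∀ y ∈ B, y < x) ∧ (∀ y ∈ Bs.headD ∅, x ≤ y) then insert x B :: Bs
    else B :: crowdNumber x Bs

/-- The rows of `T` (the part below some row `i`) with an entry that sends its box to row `i`,
listed from bottom to top: an entry `t` in the row with index `k`, which is row `i + k + 1`, belongs
to row `i + k + 1 - t`. -/
def sources (T : List (List ℕ)) : List ℕ :=
  ((List.range T.length).filter (fun k => k + 1 ∈ T.getD k [])).reverse

/-- One crowding step into the set-valued row `R`, with the pair `(T, U)` below it: reverse RSK from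
the last box of row `k` of `U`, the number that comes out being put into `R`; that box is removed
from `U` and from `T`. -/
def crowdStep (s : List (Finset ℕ) × List (List ℕ) × List (List ℕ)) (k : ℕ) :
    List (Finset ℕ) × List (List ℕ) × List (List ℕ) :=
  (crowdNumber (rskDelete k s.2.2).2 s.1, removeBox k s.2.1, (rskDelete k s.2.2).1)

/-- Crowd `n` rows, from top to bottom; the boxes belonging to one row are treated from bottom to
top. -/
def crowdRows : ℕ → List (List ℕ) → List (List ℕ) → List (List (Finset ℕ))
  | n + 1, _ :: T, R :: U =>
    let s := (sources T).foldl crowdStep (R.map (fun x => {x}), T, U)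
    s.1 :: crowdRows n s.2.1 s.2.2
  | _, _, _ => []

/-- The map `crowd`: all rows of the pair are treated. -/
def crowd (p : List (List ℕ) × List (List ℕ)) : List (List (Finset ℕ)) :=
  crowdRows p.2.length p.1 p.2

/-! ### Weights -/

/-- The exponent of `x_v` in the monomial of a set-valued tableau: the number of boxes that
contain `v`. -/
def setWeight (F : List (List (Finset ℕ))) (v : ℕ) : ℕ := F.flatten.countP (fun B => v ∈ B)

/-- The exponent of `x_v` in the monomial of a tableau: the number of boxes with entry `v`. -/
def weight (U : List (List ℕ)) (v : ℕ) : ℕ := U.flatten.count v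

/-- The total number of entries of a set-valued tableau. -/
def setSize (F : List (List (Finset ℕ))) : ℕ := (F.flatten.map Finset.card).sum

/-- The number of (filled) boxes of the skew filling `T`. -/
def skewSize (T : List (List ℕ)) : ℕ := T.flatten.countP (fun t => 0 < t)

end Crowding

namespace Crowding

/-! The rows are treated one at a time, from the bottom up, so all that matters is the exchange
between one set-valued row `R` and the pair `(T, U)` below it. The extra numbers leave `R` in
strictly decreasing order (`RowOK.extrasRow_pairwise`). By the row bumping lemma
(`lt_rskInsert_rskInsert`), their new boxes then lie in strictly lower and lower rows. A box created
in the row of index `k` of `T` receives the entry `k + 1`, the largest value allowed there. Hence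
the boxes that belong to `R` are exactly those with maximal entry, `sources` lists them with the
last created first, and reverse RSK from them undoes the insertions in the opposite order.

Conversely, the lowest box with maximal entry is a corner (`TFill.corner`), so reverse RSK can start
there. The number released exceeds all extras of `R`: otherwise the other half of the row bumping
lemma (`rskInsert_rskInsert_le`) would contradict `Inv.lt`. It therefore fits into exactly one box
and becomes the new first extra. Column strictness between `R` and the first row of `U` passes in
both directions by `RowAdd.overRow_rowInsert` and `RowAdd.overRow_of_rowInsert`.

So single steps preserve the invariant `Inv` and undo each other (`Inv.exists_uncrowdNumber`,
`Inv.exists_crowdStep`), and induction on the rows gives `uncrowd_spec` and `crowdRows_spec`. In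
`TFill c` the bound is `i + c`: `c = 0` for a whole filling, `c = 1` below a row that is being
treated. The shape `lam` is read off from the number of zeros in each row of `T`, which no insertion
changes. -/

/-! ### Columnwise relations between consecutive rows -/

/-- The second row is not longer than the first, and the boxes of each column are related by `r`. -/
def Over {α β : Type*} (r : α → β → Prop) : List α → List β → Prop
  | _, [] => True
  | [], _ :: _ => False
  | a :: l, b :: m => r a b ∧ Over r l m

section Over

variable {α β : Type*} {r : α → β → Prop}

@[simp] theorem over_nil (l : List α) : Over r l [] := by cases l <;> trivial

@[simp] theorem not_nil_over (b : β) (m : List β) : ¬ Over r [] (b :: m) := id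

@[simp] theorem over_cons (a : α) (l : List α) (b : β) (m : List β) :
    Over r (a :: l) (b :: m) ↔ r a b ∧ Over r l m := Iff.rfl

theorem Over.length_le : ∀ {l : List α} {m : List β}, Over r l m → m.length ≤ l.length
  | _, [], _ => Nat.zero_le _
  | [], _ :: _, h => h.elim
  | _ :: _, _ :: _, h => Nat.succ_le_succ (Over.length_le h.2)

theorem over_iff (d : α) (e : β) : ∀ {l : List α} {m : List β},
    Over r l m ↔ m.length ≤ l.length ∧ ∀ j < m.length, r (l.getD j d) (m.getD j e)
  | l, [] => by simp
  | [], b :: m => by simp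
  | a :: l, b :: m => by
    rw [over_cons, over_iff d e]
    constructor
    · rintro ⟨h1, h2, h3⟩
      refine ⟨Nat.succ_le_succ h2, fun j hj => ?_⟩
      cases j with
      | zero => simpa using h1
      | succ j => simpa using h3 j (Nat.lt_of_succ_lt_succ hj)
    · rintro ⟨h2, h3⟩
      refine ⟨by simpa using h3 0 (by simp), Nat.le_of_succ_le_succ h2, fun j hj => ?_⟩
      simpa using h3 (j + 1) (Nat.succ_lt_succ hj)

theorem over_of_length {r : α → β → Prop} : ∀ {l : List α} {m : List β},
    m.length ≤ l.length → (∀ a ∈ l, ∀ b ∈ m, r a b) → Over r l m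
  | l, [], _, _ => over_nil l
  | [], _ :: _, h, _ => absurd h (by simp)
  | _ :: _, _ :: _, h, H =>
    ⟨H _ (by simp) _ (by simp), over_of_length (Nat.le_of_succ_le_succ h)
      fun a ha b hb => H a (by simp [ha]) b (by simp [hb])⟩

theorem Over.concat {b : β} : ∀ {l : List α} {m : List β}, Over r l m → m.length < l.length →
    (∀ a ∈ l, r a b) → Over r l (m ++ [b])
  | [], _, _, h, _ => absurd h (by simp)
  | _ :: _, [], _, _, H => ⟨H _ (by simp), over_nil _⟩
  | _ :: _, _ :: _, h, h', H =>
    ⟨h.1, h.2.concat (Nat.lt_of_succ_lt_succ h') fun a ha => H a (by simp [ha])⟩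

theorem Over.of_concat {b : β} : ∀ {l : List α} {m : List β}, Over r l (m ++ [b]) → Over r l m
  | l, [], _ => over_nil l
  | [], _ :: _, h => h.elim
  | _ :: _, _ :: _, h => ⟨h.1, h.2.of_concat⟩

theorem Over.concat_left {a : α} : ∀ {l : List α} {m : List β}, Over r l m → Over r (l ++ [a]) m
  | _, [], _ => over_nil _
  | [], _ :: _, h => h.elim
  | _ :: _, _ :: _, h => ⟨h.1, h.2.concat_left⟩

theorem Over.of_concat_left {a : α} : ∀ {l : List α} {m : List β}, Over r (l ++ [a]) m →
    m.length ≤ l.length → Over r l m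
  | _, [], _, _ => over_nil _
  | [], _ :: _, _, h => absurd h (by simp)
  | _ :: _, _ :: _, h, h' => ⟨h.1, h.2.of_concat_left (Nat.le_of_succ_le_succ h')⟩

theorem over_map_right {γ : Type*} {f : γ → β} : ∀ {l : List α} {m : List γ},
    Over r l (m.map f) ↔ Over (fun a c => r a (f c)) l m
  | l, [] => by simp
  | [], _ :: _ => Iff.rfl
  | _ :: _, _ :: _ => and_congr Iff.rfl over_map_right

theorem over_map_left {γ : Type*} {f : γ → α} : ∀ {l : List γ} {m : List β},
    Over r (l.map f) m ↔ Over (fun a c => r (f a) c) l m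
  | l, [] => by simp
  | [], _ :: _ => Iff.rfl
  | _ :: _, _ :: _ => and_congr Iff.rfl over_map_left

theorem Over.imp {s : α → β → Prop} : ∀ {l : List α} {m : List β},
    (∀ a ∈ l, ∀ b ∈ m, r a b → s a b) → Over r l m → Over s l m
  | l, [], _, _ => over_nil l
  | [], _ :: _, _, h => h
  | _ :: _, _ :: _, H, h =>
    ⟨H _ (by simp) _ (by simp) h.1, h.2.imp fun a ha b hb => H a (by simp [ha]) b (by simp [hb])⟩

end Over

/-! ### Inserting into a row -/

theorem rowInsert_cons_of_lt {x y : ℕ} (h : x < y) (ys : List ℕ) :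
    rowInsert x (y :: ys) = (x :: ys, some y) := by simp [rowInsert, h]

theorem rowInsert_cons_of_le {x y : ℕ} (h : y ≤ x) (ys : List ℕ) :
    rowInsert x (y :: ys) = (y :: (rowInsert x ys).1, (rowInsert x ys).2) := by
  simp [rowInsert, not_lt.mpr h]

theorem lt_of_rowInsert_eq_some {x y : ℕ} : ∀ {R : List ℕ}, (rowInsert x R).2 = some y → x < y
  | [], h => by simp [rowInsert] at h
  | z :: zs, h => by
    rcases lt_or_ge x z with hz | hz
    · rw [rowInsert_cons_of_lt hz] at h
      simp only [Option.some.injEq] at h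
      omega
    · rw [rowInsert_cons_of_le hz] at h
      exact lt_of_rowInsert_eq_some h

theorem rowInsert_of_eq_none {x : ℕ} : ∀ {R : List ℕ}, (rowInsert x R).2 = none →
    (rowInsert x R).1 = R ++ [x] ∧ ∀ z ∈ R, z ≤ x
  | [], _ => by simp [rowInsert]
  | z :: zs, h => by
    rcases lt_or_ge x z with hz | hz
    · simp [rowInsert_cons_of_lt hz] at h
    · rw [rowInsert_cons_of_le hz] at h ⊢
      obtain ⟨h1, h2⟩ := rowInsert_of_eq_none h
      simp [h1, hz]
      exact h2

theorem rowInsert_of_forall_le {x : ℕ} : ∀ {R : List ℕ}, (∀ z ∈ R, z ≤ x) →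
    rowInsert x R = (R ++ [x], none)
  | [], _ => rfl
  | z :: zs, h => by
    rw [rowInsert_cons_of_le (h z (by simp)), rowInsert_of_forall_le fun w hw => h w (by simp [hw])]
    rfl

theorem length_rowInsert_of_eq_some {x y : ℕ} : ∀ {R : List ℕ}, (rowInsert x R).2 = some y →
    (rowInsert x R).1.length = R.length
  | [], h => by simp [rowInsert] at h
  | z :: zs, h => by
    rcases lt_or_ge x z with hz | hz
    · simp [rowInsert_cons_of_lt hz]
    · rw [rowInsert_cons_of_le hz] at h ⊢
      simp [length_rowInsert_of_eq_some h]

open scoped List in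
theorem rowInsert_perm (x : ℕ) : ∀ R : List ℕ,
    (rowInsert x R).1 ++ (rowInsert x R).2.toList ~ x :: R
  | [] => by simp [rowInsert]
  | z :: zs => by
    rcases lt_or_ge x z with hz | hz
    · rw [rowInsert_cons_of_lt hz]
      simp
    · rw [rowInsert_cons_of_le hz]
      exact ((rowInsert_perm x zs).cons z).trans (List.Perm.swap x z zs)

theorem mem_rowInsert {x z : ℕ} {R : List ℕ} (h : z ∈ (rowInsert x R).1) : z = x ∨ z ∈ R := by
  simpa using (rowInsert_perm x R).subset (List.mem_append_left _ h)

theorem rowInsert_some_mem {x y : ℕ} {R : List ℕ} (h : (rowInsert x R).2 = some y) : y ∈ R := by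
  rcases List.mem_cons.1 ((rowInsert_perm x R).subset (a := y) (by simp [h])) with rfl | hy
  · exact absurd (lt_of_rowInsert_eq_some h) (lt_irrefl _)
  · exact hy

theorem sortedLE_rowInsert {x : ℕ} : ∀ {R : List ℕ}, R.Pairwise (· ≤ ·) →
    (rowInsert x R).1.Pairwise (· ≤ ·)
  | [], _ => by simp [rowInsert]
  | z :: zs, h => by
    rw [List.pairwise_cons] at h
    rcases lt_or_ge x z with hz | hz
    · rw [rowInsert_cons_of_lt hz, List.pairwise_cons]
      exact ⟨fun w hw => hz.le.trans (h.1 w hw), h.2⟩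
    · rw [rowInsert_cons_of_le hz, List.pairwise_cons]
      refine ⟨fun w hw => ?_, sortedLE_rowInsert h.2⟩
      rcases mem_rowInsert hw with rfl | hw
      exacts [hz, h.1 w hw]

/-- The first entry of a row into which `x` was inserted is at most `x`. -/
theorem exists_rowInsert_eq_cons (x : ℕ) (R : List ℕ) :
    ∃ a R', (rowInsert x R).1 = a :: R' ∧ a ≤ x := by
  cases R with
  | nil => exact ⟨x, [], rfl, le_rfl⟩
  | cons z zs =>
    rcases lt_or_ge x z with hz | hz
    · rw [rowInsert_cons_of_lt hz]
      exact ⟨_, _, rfl, le_rfl⟩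
    · rw [rowInsert_cons_of_le hz]
      exact ⟨_, _, rfl, hz⟩

/-- Insertion only lowers an entry or lengthens the row. -/
theorem Over.rowInsert_left {x : ℕ} : ∀ {R R' : List ℕ}, Over (· < ·) R R' →
    Over (· < ·) (rowInsert x R).1 R'
  | _, [], _ => over_nil _
  | [], _ :: _, h => h.elim
  | z :: zs, c :: r, h => by
    rcases lt_or_ge x z with hz | hz
    · rw [rowInsert_cons_of_lt hz]
      exact ⟨hz.trans h.1, h.2⟩
    · rw [rowInsert_cons_of_le hz]
      exact ⟨h.1, h.2.rowInsert_left⟩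

/-- The entry below the bumped `y`, if there is one, exceeds `y`. So `y` lands weakly to the left of
the column it left, below an entry that is at most `x < y`. -/
theorem Over.rowInsert_bump {x y : ℕ} : ∀ {R R' : List ℕ}, (rowInsert x R).2 = some y →
    Over (· < ·) R R' → Over (· < ·) (rowInsert x R).1 (rowInsert y R').1
  | [], _, hy, _ => by simp [rowInsert] at hy
  | z :: zs, r, hy, h => by
    have hxy := lt_of_rowInsert_eq_some hy
    rcases lt_or_ge x z with hz | hz
    · rw [rowInsert_cons_of_lt hz] at hy ⊢
      obtain rfl : z = y := by simpa using hy
      cases r with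
      | nil => exact ⟨hz, over_nil _⟩
      | cons c r =>
        rw [rowInsert_cons_of_lt h.1]
        exact ⟨hz, h.2⟩
    · rw [rowInsert_cons_of_le hz] at hy ⊢
      cases r with
      | nil => exact ⟨lt_of_le_of_lt hz hxy, over_nil _⟩
      | cons c r =>
        rcases lt_or_ge y c with hc | hc
        · rw [rowInsert_cons_of_lt hc]
          exact ⟨lt_of_le_of_lt hz hxy, h.2.rowInsert_left⟩
        · rw [rowInsert_cons_of_le hc]
          exact ⟨h.1, h.2.rowInsert_bump hy⟩

theorem Over.of_rowInsert_left {x y : ℕ} : ∀ {R R' : List ℕ}, (rowInsert x R).2 = some y →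
    (∀ c ∈ R', y < c) → Over (· < ·) (rowInsert x R).1 R' → Over (· < ·) R R'
  | _, [], _, _, _ => over_nil _
  | [], _ :: _, hy, _, _ => by simp [rowInsert] at hy
  | z :: zs, c :: r, hy, hc, h => by
    rcases lt_or_ge x z with hz | hz
    · rw [rowInsert_cons_of_lt hz] at hy h
      obtain rfl : z = y := by simpa using hy
      exact ⟨hc c (by simp), h.2⟩
    · rw [rowInsert_cons_of_le hz] at hy h
      exact ⟨h.1, h.2.of_rowInsert_left hy fun c hc' => hc c (by simp [hc'])⟩

/-- This is the column condition needed for reverse bumping: the columns after the insertions force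
`y` to have moved weakly to the left. -/
theorem Over.of_rowInsert_bump {x y : ℕ} : ∀ {R R' : List ℕ}, (rowInsert x R).2 = some y →
    R.Pairwise (· ≤ ·) → R'.Pairwise (· ≤ ·) →
    Over (· < ·) (rowInsert x R).1 (rowInsert y R').1 → Over (· < ·) R R'
  | [], _, hy, _, _, _ => by simp [rowInsert] at hy
  | _ :: _, [], _, _, _, _ => over_nil _
  | z :: zs, c :: r, hy, hR, hR', h => by
    rw [List.pairwise_cons] at hR hR'
    have hxy := lt_of_rowInsert_eq_some hy
    rcases lt_or_ge x z with hz | hz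
    · rw [rowInsert_cons_of_lt hz] at hy h
      obtain rfl : z = y := by simpa using hy
      rcases lt_or_ge z c with hc | hc
      · rw [rowInsert_cons_of_lt hc] at h
        exact ⟨hc, h.2⟩
      · rw [rowInsert_cons_of_le hc] at h
        -- The bumped `z` would move strictly to the right. Then the next lower entry `a ≤ z` would
        -- have to exceed the entry `w ≥ z` above it.
        obtain ⟨a, R', e, ha⟩ := exists_rowInsert_eq_cons z r
        have h2 := h.2
        simp only [e] at h2
        cases zs with
        | nil => exact h2.elim
        | cons w ws =>
          have := hR.1 w (by simp)
          have := h2.1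
          omega
    · rw [rowInsert_cons_of_le hz] at hy h
      rcases lt_or_ge y c with hc | hc
      · rw [rowInsert_cons_of_lt hc] at h
        exact ⟨by omega, h.2.of_rowInsert_left hy fun d hd => lt_of_lt_of_le hc (hR'.1 d hd)⟩
      · rw [rowInsert_cons_of_le hc] at h
        exact ⟨h.1, h.2.of_rowInsert_bump hy hR.2 hR'.2⟩

/-! ### Deleting from a row -/

/-- After the insertion `x` stands where `y` was, and everything to its right is at least `y`; so
`x` is the rightmost entry less than `y`. -/
theorem rowDelete_rowInsert {x y : ℕ} : ∀ {R : List ℕ}, R.Pairwise (· ≤ ·) →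
    (rowInsert x R).2 = some y → rowDelete y (rowInsert x R).1 = (R, x)
  | [], _, hy => by simp [rowInsert] at hy
  | z :: zs, hR, hy => by
    rw [List.pairwise_cons] at hR
    have hxy := lt_of_rowInsert_eq_some hy
    rcases lt_or_ge x z with hz | hz
    · rw [rowInsert_cons_of_lt hz] at hy ⊢
      obtain rfl : z = y := by simpa using hy
      have : ¬ ∃ w ∈ zs, w < z := by
        rintro ⟨w, hw, h⟩
        exact absurd (hR.1 w hw) (by omega)
      simp [rowDelete, this]
    · rw [rowInsert_cons_of_le hz] at hy ⊢
      have hx : x ∈ (rowInsert x zs).1 := by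
        have := (rowInsert_perm x zs).symm.subset (a := x) (by simp)
        rw [hy] at this
        simp at this
        rcases this with h | h
        · exact h
        · omega
      simp only [rowDelete]
      rw [if_pos ⟨x, hx, hxy⟩, rowDelete_rowInsert hR.2 hy]

theorem rowInsert_rowDelete {y : ℕ} : ∀ {R : List ℕ}, R.Pairwise (· ≤ ·) → (∃ w ∈ R, w < y) →
    rowInsert (rowDelete y R).2 (rowDelete y R).1 = (R, some y) ∧
      (rowDelete y R).1.Pairwise (· ≤ ·) ∧ (∀ w ∈ (rowDelete y R).1, w = y ∨ w ∈ R) ∧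
      (rowDelete y R).2 ∈ R
  | [], _, h => by simp at h
  | z :: zs, hR, h => by
    rw [List.pairwise_cons] at hR
    simp only [rowDelete]
    split_ifs with hw
    · obtain ⟨h1, h2, h3, h4⟩ := rowInsert_rowDelete hR.2 hw
      refine ⟨?_, ?_, ?_, by simp [h4]⟩
      · rw [rowInsert_cons_of_le (hR.1 _ h4), h1]
      · rw [List.pairwise_cons]
        refine ⟨fun w hw' => ?_, h2⟩
        rcases h3 w hw' with rfl | h
        · obtain ⟨v, hv, hv'⟩ := hw
          exact (hR.1 v hv).trans hv'.le
        · exact hR.1 w h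
      · intro w hw'
        rcases List.mem_cons.1 hw' with rfl | h
        · simp
        · rcases h3 w h with h | h <;> simp [h]
    · push Not at hw
      have hz : z < y := by
        obtain ⟨w, hw1, hw2⟩ := h
        rcases List.mem_cons.1 hw1 with rfl | h
        · exact hw2
        · exact absurd hw2 (not_lt.2 (hw w h))
      refine ⟨rowInsert_cons_of_lt hz zs, List.pairwise_cons.2 ⟨hw, hR.2⟩, ?_, by simp⟩
      intro w hw'
      rcases List.mem_cons.1 hw' with rfl | h
      · simp
      · simp [h]

/-! ### Semistandard tableaux as lists of rows -/

/-- Semistandard tableaux with positive entries and nonempty rows. -/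
def Tab : List (List ℕ) → Prop
  | [] => True
  | R :: Rs => R ≠ [] ∧ R.Pairwise (· ≤ ·) ∧ (∀ x ∈ R, 0 < x) ∧ Over (· < ·) R (Rs.headD []) ∧ Tab Rs

theorem Tab.headD_sorted {U : List (List ℕ)} (h : Tab U) : (U.headD []).Pairwise (· ≤ ·) := by
  cases U with
  | nil => simp
  | cons R Rs => exact h.2.1

theorem rskInsert_cons_of_none {x : ℕ} {R : List ℕ} (h : (rowInsert x R).2 = none)
    (Rs : List (List ℕ)) : rskInsert x (R :: Rs) = ((rowInsert x R).1 :: Rs, 0) := by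
  rw [rskInsert]
  split
  · next e => rw [e]
  · next e => rw [e] at h; simp at h

theorem rskInsert_cons_of_some {x y : ℕ} {R : List ℕ} (h : (rowInsert x R).2 = some y)
    (Rs : List (List ℕ)) : rskInsert x (R :: Rs) =
      ((rowInsert x R).1 :: (rskInsert y Rs).1, (rskInsert y Rs).2 + 1) := by
  rw [rskInsert]
  split
  · next e => rw [e] at h; simp at h
  · next e =>
    rw [e] at h
    obtain rfl : _ = y := by simpa using h
    rw [e]

/-- A row interacts with the tableau below it only through the first row of that tableau; the
default `[]` covers the empty tableau. -/
theorem headD_rskInsert (x : ℕ) (U : List (List ℕ)) :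
    (rskInsert x U).1.headD [] = (rowInsert x (U.headD [])).1 := by
  cases U with
  | nil => rfl
  | cons R Rs =>
    cases h : (rowInsert x R).2 with
    | none => rw [rskInsert_cons_of_none h]; rfl
    | some y => rw [rskInsert_cons_of_some h]; rfl

theorem rowInsert_ne_nil (x : ℕ) (R : List ℕ) : (rowInsert x R).1 ≠ [] := by
  obtain ⟨a, R', h, -⟩ := exists_rowInsert_eq_cons x R
  simp [h]

theorem Tab.rskInsert {x : ℕ} (hx : 0 < x) {U : List (List ℕ)} (hU : Tab U) :
    Tab (rskInsert x U).1 := by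
  induction U generalizing x with
  | nil => simp [Crowding.rskInsert, Tab, hx]
  | cons R Rs ih =>
    obtain ⟨h1, h2, h3, h4, h5⟩ := hU
    have hp : ∀ z ∈ (rowInsert x R).1, 0 < z := by
      intro z hz
      rcases mem_rowInsert hz with rfl | hz
      exacts [hx, h3 z hz]
    cases h : (rowInsert x R).2 with
    | none =>
      rw [rskInsert_cons_of_none h]
      exact ⟨rowInsert_ne_nil x R, sortedLE_rowInsert h2, hp, h4.rowInsert_left, h5⟩
    | some y =>
      rw [rskInsert_cons_of_some h]
      refine ⟨rowInsert_ne_nil x R, sortedLE_rowInsert h2, hp, ?_, ih (h3 y (rowInsert_some_mem h)) h5⟩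
      rw [headD_rskInsert]
      exact h4.rowInsert_bump h

open scoped List in
theorem flatten_rskInsert_perm (x : ℕ) (U : List (List ℕ)) :
    (rskInsert x U).1.flatten ~ x :: U.flatten := by
  induction U generalizing x with
  | nil => simp [rskInsert]
  | cons R Rs ih =>
    have hp := rowInsert_perm x R
    cases h : (rowInsert x R).2 with
    | none =>
      rw [rskInsert_cons_of_none h]
      rw [h] at hp
      simpa using hp.append_right Rs.flatten
    | some y =>
      rw [rskInsert_cons_of_some h]
      rw [h] at hp
      have h1 := (ih y).append_left (rowInsert x R).1
      have h2 := hp.append_right Rs.flatten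
      simp only [Option.toList_some, List.append_assoc, List.singleton_append] at h2
      exact h1.trans h2

/-! ### Row bumping -/

/-- The second number passes the place taken by `x`, so it bumps an entry further to the right. -/
theorem le_of_mem_rowInsert_rowInsert {x x' y y' : ℕ} (hx : x ≤ x') : ∀ {R : List ℕ},
    R.Pairwise (· ≤ ·) → (rowInsert x R).2 = some y →
    (rowInsert x' (rowInsert x R).1).2 = some y' → y ≤ y'
  | [], _, h, _ => by simp [rowInsert] at h
  | z :: zs, hR, h, h' => by
    rw [List.pairwise_cons] at hR
    rcases lt_or_ge x z with hz | hz
    · rw [rowInsert_cons_of_lt hz] at h h'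
      obtain rfl : z = y := by simpa using h
      rw [rowInsert_cons_of_le hx] at h'
      exact hR.1 _ (rowInsert_some_mem h')
    · rw [rowInsert_cons_of_le hz] at h h'
      rw [rowInsert_cons_of_le (hz.trans hx)] at h'
      exact le_of_mem_rowInsert_rowInsert hx hR.2 h h'

/-- Used for the row that has just received `x`: the smaller `x'` must bump something there, and
what it bumps is less than anything `x` has bumped. -/
theorem exists_rowInsert_eq_some {x x' : ℕ} (hx : x' < x) : ∀ {R : List ℕ},
    R.Pairwise (· ≤ ·) → x ∈ R → ∃ y, (rowInsert x' R).2 = some y ∧ y ≤ x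
  | [], _, h => by simp at h
  | z :: zs, hR, h => by
    rw [List.pairwise_cons] at hR
    have hzx : z ≤ x := by
      rcases List.mem_cons.1 h with rfl | h
      exacts [le_rfl, hR.1 x h]
    rcases lt_or_ge x' z with hz | hz
    · rw [rowInsert_cons_of_lt hz]
      exact ⟨z, rfl, hzx⟩
    · rw [rowInsert_cons_of_le hz]
      rcases List.mem_cons.1 h with rfl | h
      · omega
      · exact exists_rowInsert_eq_some hx hR.2 h

theorem mem_rowInsert_self (x : ℕ) (R : List ℕ) : x ∈ (rowInsert x R).1 := by
  have h := (rowInsert_perm x R).symm.subset (a := x) (by simp)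
  rcases List.mem_append.1 h with h | h
  · exact h
  · exact absurd (lt_of_rowInsert_eq_some (by simpa using h)) (lt_irrefl x)

/-- Row bumping lemma, weakly increasing case: the bumped numbers are again weakly increasing, and
once the first insertion ends in a row, the second cannot get past it. -/
theorem rskInsert_rskInsert_le {x x' : ℕ} (hx : x ≤ x') {U : List (List ℕ)} (hU : Tab U) :
    (rskInsert x' (rskInsert x U).1).2 ≤ (rskInsert x U).2 := by
  induction U generalizing x x' with
  | nil =>
    have h : (rowInsert x' [x]).2 = none := by
      rw [rowInsert_of_forall_le (by simpa using hx)]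
    rw [rskInsert, rskInsert_cons_of_none h]
  | cons R Rs ih =>
    obtain ⟨-, h2, -, -, h5⟩ := hU
    cases h : (rowInsert x R).2 with
    | none =>
      rw [rskInsert_cons_of_none h]
      obtain ⟨e, hR⟩ := rowInsert_of_eq_none h
      rw [rskInsert_cons_of_none]
      rw [e, rowInsert_of_forall_le]
      intro z hz
      rcases List.mem_append.1 hz with hz | hz
      · exact (hR z hz).trans hx
      · obtain rfl : z = x := by simpa using hz
        exact hx
    | some y =>
      rw [rskInsert_cons_of_some h]
      cases h' : (rowInsert x' (rowInsert x R).1).2 with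
      | none => rw [rskInsert_cons_of_none h']; exact Nat.zero_le _
      | some y' =>
        rw [rskInsert_cons_of_some h']
        exact Nat.succ_le_succ (ih (le_of_mem_rowInsert_rowInsert hx h2 h h') h5)

/-- Row bumping lemma, strictly decreasing case: the second insertion bumps in every row that the
first one reaches, including the row where the first one ends. -/
theorem lt_rskInsert_rskInsert {x x' : ℕ} (hx : x' < x) {U : List (List ℕ)} (hU : Tab U) :
    (rskInsert x U).2 < (rskInsert x' (rskInsert x U).1).2 := by
  induction U generalizing x x' with
  | nil =>
    have h : (rowInsert x' [x]).2 = some x := by rw [rowInsert_cons_of_lt hx]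
    rw [rskInsert, rskInsert_cons_of_some h]
    exact Nat.succ_pos _
  | cons R Rs ih =>
    obtain ⟨-, h2, -, -, h5⟩ := hU
    obtain ⟨y', h', hy'⟩ := exists_rowInsert_eq_some hx (sortedLE_rowInsert (x := x) h2)
      (mem_rowInsert_self x R)
    cases h : (rowInsert x R).2 with
    | none =>
      rw [rskInsert_cons_of_none h, rskInsert_cons_of_some h']
      exact Nat.succ_pos _
    | some y =>
      rw [rskInsert_cons_of_some h, rskInsert_cons_of_some h']
      exact Nat.succ_lt_succ (ih (lt_of_le_of_lt hy' (lt_of_rowInsert_eq_some h)) h5)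

/-! ### Reverse RSK -/

theorem rskDelete_rskInsert (x : ℕ) {U : List (List ℕ)} (hU : Tab U) :
    rskDelete (rskInsert x U).2 (rskInsert x U).1 = (U, x) := by
  induction U generalizing x with
  | nil => rfl
  | cons R Rs ih =>
    obtain ⟨h1, h2, -, -, h5⟩ := hU
    cases h : (rowInsert x R).2 with
    | none =>
      rw [rskInsert_cons_of_none h, (rowInsert_of_eq_none h).1]
      have : 0 < R.length := List.length_pos_iff.2 h1
      simp [rskDelete, removeBox, h1, List.getLastD_eq_getLast?]
    | some y =>
      rw [rskInsert_cons_of_some h, rskDelete, ih y h5, rowDelete_rowInsert h2 h]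

/-- The hypothesis says that row `k` ends in a corner. The membership claim makes the released
number positive and carries the induction from row to row. -/
theorem rskInsert_rskDelete {k : ℕ} {U : List (List ℕ)} (hU : Tab U)
    (hk : (U.getD (k + 1) []).length < (U.getD k []).length) :
    Tab (rskDelete k U).1 ∧ rskInsert (rskDelete k U).2 (rskDelete k U).1 = (U, k) ∧
      (rskDelete k U).2 ∈ U.headD [] := by
  induction U generalizing k with
  | nil => simp at hk
  | cons R Rs ih =>
    obtain ⟨h1, h2, h3, h4, h5⟩ := hU
    cases k with
    | zero =>
      rcases List.eq_nil_or_concat R with rfl | ⟨L, b, rfl⟩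
      · exact absurd rfl h1
      simp only [List.concat_eq_append] at *
      cases L with
      | nil =>
        obtain rfl : Rs = [] := by
          cases Rs with
          | nil => rfl
          | cons S Rs => exact absurd (List.length_pos_iff.2 h5.1) (by simpa using hk)
        simp [rskDelete, removeBox, Tab, rskInsert]
      | cons a L =>
        have e : rskDelete 0 ((a :: L ++ [b]) :: Rs) = ((a :: L) :: Rs, b) := by
          have : (a :: L ++ [b]).getLast? = some b := List.getLast?_concat
          have h' : (a :: L ++ [b]).dropLast = a :: L := List.dropLast_concat
          rw [rskDelete, removeBox, if_neg (by simp), h', List.getLastD_eq_getLast?, this]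
          rfl
        rw [e]
        rw [List.pairwise_append] at h2
        refine ⟨⟨by simp, h2.1, fun x hx => h3 x (List.mem_append_left _ hx), ?_, h5⟩, ?_, by simp⟩
        · refine h4.of_concat_left ?_
          cases Rs with
          | nil => simp
          | cons S Rs =>
            simp at hk ⊢
            omega
        · have hb := rowInsert_of_forall_le fun z hz => h2.2.2 z hz b (by simp)
          rw [rskInsert_cons_of_none (by rw [hb]), hb]
    | succ k =>
      obtain ⟨i1, i2, i3⟩ := ih h5 (by simpa using hk)
      simp only [rskDelete]
      set U' := (rskDelete k Rs).1
      set y := (rskDelete k Rs).2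
      have hhead : Rs.headD [] = (rowInsert y (U'.headD [])).1 := by
        rw [← headD_rskInsert, i2]
      -- The first entry of the next row is at most `y`, since that row arises by inserting `y`; the
      -- entry of `R` above it is smaller still.
      have hw : ∃ w ∈ R, w < y := by
        obtain ⟨a, r, e, ha⟩ := exists_rowInsert_eq_cons y (U'.headD [])
        rw [hhead, e] at h4
        cases R with
        | nil => exact h4.elim
        | cons w ws => exact ⟨w, by simp, lt_of_lt_of_le h4.1 ha⟩
      obtain ⟨j1, j2, j3, j4⟩ := rowInsert_rowDelete h2 hw
      set R' := (rowDelete y R).1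
      set x := (rowDelete y R).2
      have hs : (rowInsert x R').2 = some y := by rw [j1]
      have hy : 0 < y := by
        obtain ⟨w, -, hw⟩ := hw
        omega
      refine ⟨⟨?_, j2, ?_, ?_, i1⟩, ?_, j4⟩
      · have := length_rowInsert_of_eq_some hs
        rw [j1] at this
        exact List.ne_nil_of_length_pos (this ▸ List.length_pos_iff.2 h1)
      · intro w hw
        rcases j3 w hw with rfl | h
        exacts [hy, h3 w h]
      · refine Over.of_rowInsert_bump hs j2 i1.headD_sorted ?_
        rw [j1, ← hhead]
        exact h4
      · rw [rskInsert_cons_of_some hs, j1, i2]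

/-! ### Adding and removing boxes -/

theorem map_length_appendBox (a x : ℕ) {T : List (List ℕ)} {U : List (List ℕ)}
    (h : T.map List.length = U.map List.length) :
    (appendBox a (rskInsert x U).2 T).map List.length = (rskInsert x U).1.map List.length := by
  induction U generalizing T x with
  | nil =>
    obtain rfl : T = [] := by simpa using h
    simp [rskInsert, appendBox]
  | cons R Rs ih =>
    cases T with
    | nil => simp at h
    | cons S T =>
      simp only [List.map_cons, List.cons.injEq] at h
      cases h' : (rowInsert x R).2 with
      | none =>
        rw [rskInsert_cons_of_none h', (rowInsert_of_eq_none h').1]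
        simp [appendBox, h]
      | some y =>
        rw [rskInsert_cons_of_some h']
        simp [appendBox, length_rowInsert_of_eq_some h', h.1, ih y h.2]

theorem length_rowDelete (y : ℕ) : ∀ R : List ℕ, (rowDelete y R).1.length = R.length
  | [] => rfl
  | z :: zs => by
    simp only [rowDelete]
    split_ifs <;> simp [length_rowDelete y zs]

theorem map_length_removeBox (k : ℕ) {T U : List (List ℕ)}
    (h : T.map List.length = U.map List.length) :
    (removeBox k T).map List.length = (rskDelete k U).1.map List.length := by
  induction U generalizing T k with
  | nil =>
    obtain rfl : T = [] := by simpa using h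
    cases k <;> rfl
  | cons R Rs ih =>
    cases T with
    | nil => simp at h
    | cons S T =>
      simp only [List.map_cons, List.cons.injEq] at h
      cases k with
      | zero =>
        simp only [removeBox, rskDelete, h.1]
        split_ifs <;> simp [h]
      | succ k => simp [removeBox, rskDelete, length_rowDelete, h.1, ih k h.2]

theorem snd_rskInsert_le (x : ℕ) (U : List (List ℕ)) : (rskInsert x U).2 ≤ U.length := by
  induction U generalizing x with
  | nil => simp [rskInsert]
  | cons R Rs ih =>
    cases h : (rowInsert x R).2 with
    | none => rw [rskInsert_cons_of_none h]; exact Nat.zero_le _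
    | some y => rw [rskInsert_cons_of_some h]; exact Nat.succ_le_succ (ih y)

theorem length_le_rskInsert (x : ℕ) (U : List (List ℕ)) :
    U.length ≤ (rskInsert x U).1.length := by
  induction U generalizing x with
  | nil => simp
  | cons R Rs ih =>
    cases h : (rowInsert x R).2 with
    | none => rw [rskInsert_cons_of_none h]; simp
    | some y => rw [rskInsert_cons_of_some h]; exact Nat.succ_le_succ (ih y)

/-- `removeBox` deletes a row that becomes empty, so an empty row of `T`, or the padding added by
`appendBox` when `k > T.length`, would not be restored. -/
theorem removeBox_appendBox (a : ℕ) {k : ℕ} {T : List (List ℕ)} (hT : [] ∉ T)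
    (hk : k ≤ T.length) : removeBox k (appendBox a k T) = T := by
  induction T generalizing k with
  | nil =>
    obtain rfl : k = 0 := by simpa using hk
    rfl
  | cons R T ih =>
    simp only [List.mem_cons, not_or] at hT
    cases k with
    | zero =>
      have : 0 < R.length := List.length_pos_iff.2 (Ne.symm hT.1)
      simp [appendBox, removeBox, Ne.symm hT.1]
    | succ k => simp [appendBox, removeBox, ih hT.2 (Nat.le_of_succ_le_succ hk)]

theorem getD_appendBox (a k : ℕ) (T : List (List ℕ)) (i : ℕ) :
    (appendBox a k T).getD i [] = if i = k then T.getD k [] ++ [a] else T.getD i [] := by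
  induction k generalizing T i with
  | zero => cases T <;> cases i <;> simp [appendBox]
  | succ k ih =>
    cases T <;> cases i <;> simp only [appendBox, List.getD_cons_zero, List.getD_cons_succ, ih]
    all_goals simp

open scoped List in
theorem flatten_appendBox_perm (a k : ℕ) (T : List (List ℕ)) :
    (appendBox a k T).flatten ~ a :: T.flatten := by
  induction k generalizing T with
  | zero =>
    cases T with
    | nil => simp [appendBox]
    | cons R T => simp [appendBox]
  | succ k ih =>
    cases T with
    | nil => exact ih []
    | cons R T => exact ((ih T).append_left R).trans List.perm_middle

/-! ### Boxes and rows of set-valued tableaux -/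

theorem extras_append_boxMin {B : Finset ℕ} (h : B.Nonempty) :
    extras B ++ [boxMin B] = B.sort (· ≥ ·) := by
  have hne : B.sort (· ≥ ·) ≠ [] := by
    obtain ⟨x, hx⟩ := h
    exact List.ne_nil_of_mem ((Finset.mem_sort _).2 hx)
  rw [extras, boxMin, List.getLastD_eq_getLast?, List.getLast?_eq_some_getLast hne]
  exact List.dropLast_append_getLast hne

theorem mem_iff_extras {B : Finset ℕ} (h : B.Nonempty) {x : ℕ} :
    x ∈ B ↔ x ∈ extras B ∨ x = boxMin B := by
  rw [← Finset.mem_sort (· ≥ ·), ← extras_append_boxMin h]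
  simp

theorem boxMin_mem {B : Finset ℕ} (h : B.Nonempty) : boxMin B ∈ B :=
  (mem_iff_extras h).2 (Or.inr rfl)

theorem boxMin_lt_of_mem_extras {B : Finset ℕ} (h : B.Nonempty) {x : ℕ} (hx : x ∈ extras B) :
    boxMin B < x := by
  have h1 := Finset.sortedGT_sort B
  rw [← extras_append_boxMin h] at h1
  exact (List.pairwise_append.1 h1.pairwise).2.2 x hx _ (by simp)

theorem boxMin_le {B : Finset ℕ} {x : ℕ} (hx : x ∈ B) : boxMin B ≤ x := by
  rcases (mem_iff_extras ⟨x, hx⟩).1 hx with h | h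
  exacts [(boxMin_lt_of_mem_extras ⟨x, hx⟩ h).le, h.ge]

@[simp] theorem extras_singleton (x : ℕ) : extras {x} = [] := by simp [extras]

@[simp] theorem boxMin_singleton (x : ℕ) : boxMin {x} = x := by simp [boxMin]

theorem eq_singleton_of_extras {B : Finset ℕ} (h : B.Nonempty) (he : extras B = []) :
    B = {boxMin B} := by
  ext x
  rw [mem_iff_extras h, he]
  simp

theorem sort_insert_of_forall_lt {B : Finset ℕ} {x : ℕ} (hx : ∀ y ∈ B, y < x) :
    (insert x B).sort (· ≥ ·) = x :: B.sort (· ≥ ·) :=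
  Finset.sort_insert _ (fun y hy => (hx y hy).le) fun h => lt_irrefl x (hx x h)

theorem extras_insert {B : Finset ℕ} (h : B.Nonempty) {x : ℕ} (hx : ∀ y ∈ B, y < x) :
    extras (insert x B) = x :: extras B := by
  rw [extras, sort_insert_of_forall_lt hx, ← extras_append_boxMin h, ← List.cons_append,
    List.dropLast_concat]

theorem boxMin_insert {B : Finset ℕ} (h : B.Nonempty) {x : ℕ} (hx : ∀ y ∈ B, y < x) :
    boxMin (insert x B) = boxMin B := by
  rw [boxMin, sort_insert_of_forall_lt hx, ← extras_append_boxMin h, ← List.cons_append,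
    List.getLastD_concat]

/-- A box with extra numbers is obtained by putting the largest one into a smaller box. -/
theorem exists_eq_insert {B : Finset ℕ} {x : ℕ} {xs : List ℕ} (h : extras B = x :: xs) :
    ∃ C : Finset ℕ, C.Nonempty ∧ (∀ y ∈ C, y < x) ∧ B = insert x C := by
  have hB : B.Nonempty := by
    rw [Finset.nonempty_iff_ne_empty]
    rintro rfl
    simp [extras] at h
  have hs := extras_append_boxMin hB
  rw [h] at hs
  have hx : x ∈ B := (mem_iff_extras hB).2 (by simp [h])
  have hp := (Finset.sortedGT_sort B).pairwise
  rw [← hs, List.cons_append, List.pairwise_cons] at hp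
  refine ⟨B.erase x, ⟨boxMin B, Finset.mem_erase.2 ⟨?_, boxMin_mem hB⟩⟩, fun y hy => ?_,
    (Finset.insert_erase hx).symm⟩
  · exact (hp.1 _ (by simp)).ne
  · obtain ⟨h1, h2⟩ := Finset.mem_erase.1 hy
    rw [← Finset.mem_sort (· ≥ ·), ← hs] at h2
    rcases List.mem_cons.1 h2 with h2 | h2
    exacts [absurd h2 h1, hp.1 y h2]

/-- The numbers that leave the row `R` of a set-valued tableau, in this order. -/
def extrasRow (R : List (Finset ℕ)) : List ℕ := R.reverse.flatMap extras

@[simp] theorem extrasRow_nil : extrasRow [] = [] := rfl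

@[simp] theorem extrasRow_cons (B : Finset ℕ) (Bs : List (Finset ℕ)) :
    extrasRow (B :: Bs) = extrasRow Bs ++ extras B := by simp [extrasRow]

/-- Rows of set-valued tableaux. -/
structure RowOK (R : List (Finset ℕ)) : Prop where
  nonempty : ∀ B ∈ R, B.Nonempty
  pos : ∀ B ∈ R, ∀ x ∈ B, 0 < x
  weak : R.Pairwise fun A B => ∀ x ∈ A, ∀ y ∈ B, x ≤ y

theorem rowOK_cons {B : Finset ℕ} {Bs : List (Finset ℕ)} : RowOK (B :: Bs) ↔
    B.Nonempty ∧ (∀ x ∈ B, 0 < x) ∧ (∀ C ∈ Bs, ∀ x ∈ B, ∀ y ∈ C, x ≤ y) ∧ RowOK Bs := by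
  constructor
  · rintro ⟨h1, h2, h3⟩
    rw [List.pairwise_cons] at h3
    exact ⟨h1 B (by simp), h2 B (by simp), h3.1, fun C hC => h1 C (by simp [hC]),
      fun C hC => h2 C (by simp [hC]), h3.2⟩
  · rintro ⟨h1, h2, h3, h4, h5, h6⟩
    exact ⟨by simpa using ⟨h1, h4⟩, List.forall_mem_cons.2 ⟨h2, h5⟩, List.pairwise_cons.2 ⟨h3, h6⟩⟩

theorem exists_mem_of_mem_extrasRow {x : ℕ} {R : List (Finset ℕ)} (h : x ∈ extrasRow R) :
    ∃ B ∈ R, x ∈ extras B := by simpa [extrasRow] using h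

theorem RowOK.mem_of_mem_extrasRow {R : List (Finset ℕ)} (hR : RowOK R) {x : ℕ}
    (h : x ∈ extrasRow R) : ∃ B ∈ R, x ∈ B := by
  obtain ⟨B, hB, hx⟩ := exists_mem_of_mem_extrasRow h
  exact ⟨B, hB, (mem_iff_extras (hR.nonempty B hB)).2 (Or.inl hx)⟩

theorem eq_singletons_of_extrasRow {R : List (Finset ℕ)} (hR : ∀ B ∈ R, B.Nonempty)
    (he : extrasRow R = []) : R = (R.map boxMin).map fun x => {x} := by
  induction R with
  | nil => rfl
  | cons B Bs ih =>
    simp only [extrasRow_cons, List.append_eq_nil_iff] at he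
    simp only [List.map_cons, List.cons.injEq]
    exact ⟨eq_singleton_of_extras (hR B (by simp)) he.2, ih (fun C hC => hR C (by simp [hC])) he.1⟩

/-! ### Putting a number into a set-valued row -/

/-- The row `R'` is obtained by putting `x` into a box of the row `R`, where it exceeds all numbers
in this box and to the left of it, and no number to the right of it. -/
inductive RowAdd (x : ℕ) : List (Finset ℕ) → List (Finset ℕ) → Prop
  | here {B Bs} (hB : B.Nonempty) (h : ∀ y ∈ B, y < x) (h' : ∀ C ∈ Bs, ∀ y ∈ C, x ≤ y) :
      RowAdd x (B :: Bs) (insert x B :: Bs)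
  | there {B Bs Bs'} (h : ∀ y ∈ B, y < x) (h' : RowAdd x Bs Bs') : RowAdd x (B :: Bs) (B :: Bs')

namespace RowAdd

variable {x : ℕ} {R R' : List (Finset ℕ)}

theorem exists_head (h : RowAdd x R R') :
    ∃ B Bs, R = B :: Bs ∧ ∀ y ∈ B, y < x := by
  cases h with
  | here hB h h' => exact ⟨_, _, rfl, h⟩
  | there h h' => exact ⟨_, _, rfl, h⟩

/-- `crowdNumber` stops at the first box passing its test. Any box before the right one fails,
because its right neighbour is nonempty and holds only numbers below `x`. -/
theorem crowdNumber_eq (hR : ∀ B ∈ R, B.Nonempty) (h : RowAdd x R R') : crowdNumber x R = R' := by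
  induction h with
  | @here B Bs hB h h' =>
    rw [crowdNumber, if_pos]
    refine ⟨h, ?_⟩
    cases Bs with
    | nil => simp
    | cons C Cs => exact h' C (by simp)
  | there h h' ih =>
    rw [crowdNumber, if_neg, ih fun C hC => hR C (by simp [hC])]
    obtain ⟨B, Bs, rfl, hB⟩ := h'.exists_head
    rintro ⟨-, h2⟩
    obtain ⟨y, hy⟩ := hR B (by simp)
    exact absurd (hB y hy) (not_lt.2 (h2 y hy))

theorem map_boxMin (hR : ∀ B ∈ R, B.Nonempty) (h : RowAdd x R R') :
    R'.map boxMin = R.map boxMin := by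
  induction h with
  | here hB h h' => simp [boxMin_insert hB h]
  | there h h' ih => simp [ih fun C hC => hR C (by simp [hC])]

/-- All numbers to the right of the box that receives `x` are at least `x`, so there are no extras
there and `x` is read first. -/
theorem extrasRow_eq (hR : RowOK R) (h : RowAdd x R R')
    (he : ∀ e ∈ extrasRow R, e < x) : extrasRow R' = x :: extrasRow R := by
  induction h with
  | @here B Bs hB h h' =>
    have : extrasRow Bs = [] := by
      refine List.eq_nil_iff_forall_not_mem.2 fun e hm => ?_
      obtain ⟨C, hC, heC⟩ := (rowOK_cons.1 hR).2.2.2.mem_of_mem_extrasRow hm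
      exact absurd (he e (by simp [hm])) (not_lt.2 (h' C hC e heC))
    simp [this, extras_insert hB h]
  | there h h' ih =>
    rw [extrasRow_cons, ih (rowOK_cons.1 hR).2.2.2 fun e hm => he e (by simp [hm])]
    simp

/-- The numbers of the new row. -/
theorem exists_mem_of_mem (h : RowAdd x R R') {y : ℕ} (hy : ∃ B ∈ R', y ∈ B) :
    y = x ∨ ∃ B ∈ R, y ∈ B := by
  induction h with
  | @here B Bs _ h h' =>
    obtain ⟨C, hC, hyC⟩ := hy
    rcases List.mem_cons.1 hC with rfl | hC
    · rcases Finset.mem_insert.1 hyC with rfl | hyC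
      exacts [Or.inl rfl, Or.inr ⟨B, by simp, hyC⟩]
    · exact Or.inr ⟨C, by simp [hC], hyC⟩
  | @there B Bs Bs' h h' ih =>
    obtain ⟨C, hC, hyC⟩ := hy
    rcases List.mem_cons.1 hC with rfl | hC
    · exact Or.inr ⟨C, by simp, hyC⟩
    · rcases ih ⟨C, hC, hyC⟩ with rfl | ⟨D, hD, hyD⟩
      exacts [Or.inl rfl, Or.inr ⟨D, by simp [hD], hyD⟩]

theorem exists_mem_of_mem_left (h : RowAdd x R R') {y : ℕ} (hy : ∃ B ∈ R, y ∈ B) :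
    ∃ B ∈ R', y ∈ B := by
  induction h with
  | @here B Bs _ h h' =>
    obtain ⟨C, hC, hyC⟩ := hy
    rcases List.mem_cons.1 hC with rfl | hC
    exacts [⟨_, List.mem_cons_self, Finset.mem_insert_of_mem hyC⟩, ⟨C, by simp [hC], hyC⟩]
  | @there B Bs Bs' h h' ih =>
    obtain ⟨C, hC, hyC⟩ := hy
    rcases List.mem_cons.1 hC with rfl | hC
    · exact ⟨C, by simp, hyC⟩
    · obtain ⟨D, hD, hyD⟩ := ih ⟨C, hC, hyC⟩
      exact ⟨D, by simp [hD], hyD⟩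

theorem exists_self_mem (h : RowAdd x R R') : ∃ B ∈ R', x ∈ B := by
  induction h with
  | here => exact ⟨_, List.mem_cons_self, Finset.mem_insert_self _ _⟩
  | there h h' ih =>
    obtain ⟨D, hD, hyD⟩ := ih
    exact ⟨D, by simp [hD], hyD⟩

theorem rowOK (hx : 0 < x) (hR : RowOK R) (h : RowAdd x R R') : RowOK R' := by
  induction h with
  | @here B Bs hB h h' =>
    rw [rowOK_cons] at hR ⊢
    refine ⟨by simp, ?_, fun C hC y hy z hz => ?_, hR.2.2.2⟩
    · simpa [hx] using hR.2.1
    · rcases Finset.mem_insert.1 hy with rfl | hy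
      exacts [h' C hC z hz, hR.2.2.1 C hC y hy z hz]
  | @there B Bs Bs' h h' ih =>
    rw [rowOK_cons] at hR ⊢
    refine ⟨hR.1, hR.2.1, fun C hC y hy z hz => ?_, ih hR.2.2.2⟩
    rcases h'.exists_mem_of_mem ⟨C, hC, hz⟩ with rfl | ⟨D, hD, hzD⟩
    exacts [(h y hy).le, hR.2.2.1 D hD y hy z hzD]

theorem rowOK_left (hR : RowOK R') (h : RowAdd x R R') : RowOK R := by
  induction h with
  | @here B Bs hB h h' =>
    rw [rowOK_cons] at hR ⊢
    exact ⟨hB, fun y hy => hR.2.1 y (by simp [hy]),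
      fun C hC y hy z hz => hR.2.2.1 C hC y (by simp [hy]) z hz, hR.2.2.2⟩
  | @there B Bs Bs' h h' ih =>
    rw [rowOK_cons] at hR ⊢
    refine ⟨hR.1, hR.2.1, fun C hC y hy z hz => ?_, ih hR.2.2.2⟩
    obtain ⟨D, hD, hzD⟩ := h'.exists_mem_of_mem_left ⟨C, hC, hz⟩
    exact hR.2.2.1 D hD y hy z hzD

/-- The box is the last one whose minimum is below `x`; its other numbers are extras, hence below
`x` as well. -/
theorem exists_right (hR : RowOK R) (hx : ∃ y ∈ R.headD ∅, y < x) (he : ∀ e ∈ extrasRow R, e < x) :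
    ∃ R', RowAdd x R R' := by
  induction R with
  | nil => simp at hx
  | cons B Bs ih =>
    obtain ⟨h1, h2, h3, h4⟩ := rowOK_cons.1 hR
    have hB : ∀ y ∈ B, y < x := by
      intro y hy
      rcases (mem_iff_extras h1).1 hy with hy | rfl
      · exact he y (by simp [hy])
      · obtain ⟨z, hz, hzx⟩ := hx
        exact lt_of_le_of_lt (boxMin_le hz) hzx
    by_cases h : ∃ y ∈ Bs.headD ∅, y < x
    · obtain ⟨R', h'⟩ := ih h4 h fun e hm => he e (by simp [hm])
      exact ⟨_, there hB h'⟩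
    · push Not at h
      refine ⟨_, here h1 hB fun C hC y hy => ?_⟩
      cases Bs with
      | nil => simp at hC
      | cons D Ds =>
        rcases List.mem_cons.1 hC with rfl | hC
        · exact h y hy
        · obtain ⟨d, hd⟩ := h4.nonempty D (by simp)
          exact (h d hd).trans ((rowOK_cons.1 h4).2.2.1 C hC d hd y hy)

/-- The first extra is the maximum of the rightmost box with more than one number. -/
theorem exists_left {xs : List ℕ} (hR : RowOK R') (he : extrasRow R' = x :: xs) :
    ∃ R, RowAdd x R R' ∧ extrasRow R = xs := by
  induction R' generalizing xs with
  | nil => simp at he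
  | cons B Bs ih =>
    obtain ⟨h1, h2, h3, h4⟩ := rowOK_cons.1 hR
    rw [extrasRow_cons] at he
    cases hb : extrasRow Bs with
    | nil =>
      rw [hb, List.nil_append] at he
      obtain ⟨C, hC, hCx, rfl⟩ := exists_eq_insert he
      rw [extras_insert hC hCx, List.cons.injEq] at he
      exact ⟨_, here hC hCx fun D hD y hy => h3 D hD x (by simp) y hy, by simp [hb, he.2]⟩
    | cons z zs =>
      rw [hb, List.cons_append, List.cons.injEq] at he
      obtain ⟨rfl, he⟩ := he
      obtain ⟨R, h, hR'⟩ := ih h4 hb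
      refine ⟨_, there (fun y hy => ?_) h, by simp [hR', he]⟩
      obtain ⟨C, hC, hz⟩ := exists_mem_of_mem_extrasRow (x := z) (R := Bs) (by simp [hb])
      exact lt_of_le_of_lt (h3 C hC y hy _ (boxMin_mem (h4.nonempty C hC)))
        (boxMin_lt_of_mem_extras (h4.nonempty C hC) hz)

end RowAdd

/-- Although rows are only weakly increasing, an extra exceeds the minimum of its own box, which
bounds all numbers further left. -/
theorem RowOK.extrasRow_pairwise {R : List (Finset ℕ)} (hR : RowOK R) :
    (extrasRow R).Pairwise (· > ·) := by
  induction R with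
  | nil => simp
  | cons B Bs ih =>
    obtain ⟨h1, h2, h3, h4⟩ := rowOK_cons.1 hR
    rw [extrasRow_cons, List.pairwise_append]
    refine ⟨ih h4, ?_, fun e he f hf => ?_⟩
    · have := (Finset.sortedGT_sort B).pairwise
      rw [← extras_append_boxMin h1] at this
      exact (List.pairwise_append.1 this).1
    · obtain ⟨C, hC, heC⟩ := exists_mem_of_mem_extrasRow he
      have hn := h4.nonempty C hC
      exact lt_of_le_of_lt (h3 C hC f ((mem_iff_extras h1).2 (Or.inl hf)) _ (boxMin_mem hn))
        (boxMin_lt_of_mem_extras hn heC)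

/-! ### The first row below -/

/-- Every number of a box is less than the number below it. -/
def OverRow (R : List (Finset ℕ)) (r : List ℕ) : Prop := Over (fun B c => ∀ y ∈ B, y < c) R r

namespace RowAdd

variable {x : ℕ} {R R' : List (Finset ℕ)}

theorem overRow_left (h : RowAdd x R R') {r : List ℕ} (ho : OverRow R' r) : OverRow R r := by
  induction h generalizing r with
  | here hB h h' =>
    cases r with
    | nil => exact over_nil _
    | cons c r => exact ⟨fun y hy => ho.1 y (by simp [hy]), ho.2⟩
  | there h h' ih =>
    cases r with
    | nil => exact over_nil _
    | cons c r => exact ⟨ho.1, ih ho.2⟩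

theorem overRow_of_forall_lt (h : RowAdd x R R') {r : List ℕ} (hr : ∀ c ∈ r, x < c)
    (ho : OverRow R r) : OverRow R' r := by
  induction h generalizing r with
  | here hB h h' =>
    cases r with
    | nil => exact over_nil _
    | cons c r =>
      refine ⟨fun y hy => ?_, ho.2⟩
      rcases Finset.mem_insert.1 hy with rfl | hy
      exacts [hr c (by simp), ho.1 y hy]
  | there h h' ih =>
    cases r with
    | nil => exact over_nil _
    | cons c r => exact ⟨ho.1, ih (fun c hc => hr c (by simp [hc])) ho.2⟩

/-- The set-valued analogue of `Over.rowInsert_bump`: `x` lands weakly to the left of the box it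
leaves, and in `R` all boxes up to that one hold only numbers below `x`. -/
theorem overRow_rowInsert (h : RowAdd x R R') {r : List ℕ} (ho : OverRow R' r) :
    OverRow R (rowInsert x r).1 := by
  induction h generalizing r with
  | here hB h h' =>
    cases r with
    | nil => exact ⟨h, over_nil _⟩
    | cons c r =>
      rw [rowInsert_cons_of_lt (ho.1 x (by simp))]
      exact ⟨h, ho.2⟩
  | there h h' ih =>
    cases r with
    | nil => exact ⟨h, over_nil _⟩
    | cons c r =>
      rcases lt_or_ge x c with hc | hc
      · rw [rowInsert_cons_of_lt hc]
        exact ⟨h, h'.overRow_left ho.2⟩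
      · rw [rowInsert_cons_of_le hc]
        exact ⟨ho.1, ih ho.2⟩

theorem overRow_of_rowInsert (hR : ∀ B ∈ R, B.Nonempty) (h : RowAdd x R R') {r : List ℕ}
    (hr : r.Pairwise (· ≤ ·)) (ho : OverRow R (rowInsert x r).1) : OverRow R' r := by
  induction h generalizing r with
  | @here B Bs hB h h' =>
    cases r with
    | nil => exact over_nil _
    | cons c r =>
      rcases lt_or_ge x c with hc | hc
      · rw [rowInsert_cons_of_lt hc] at ho
        refine ⟨fun y hy => ?_, ho.2⟩
        rcases Finset.mem_insert.1 hy with rfl | hy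
        exacts [hc, (h y hy).trans hc]
      · rw [rowInsert_cons_of_le hc] at ho
        have h2 := ho.2
        -- If `x` landed further right than its box, some `a ≤ x` would lie below the box `C`, whose
        -- numbers are at least `x`.
        obtain ⟨a, r', e, ha⟩ := exists_rowInsert_eq_cons x r
        simp only [e] at h2
        cases Bs with
        | nil => exact h2.elim
        | cons C Cs =>
          obtain ⟨y, hy⟩ := hR C (by simp)
          have := h2.1 y hy
          have := h' C (by simp) y hy
          omega
  | there h h' ih =>
    cases r with
    | nil => exact over_nil _
    | cons c r =>
      rw [List.pairwise_cons] at hr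
      rcases lt_or_ge x c with hc | hc
      · rw [rowInsert_cons_of_lt hc] at ho
        exact ⟨fun y hy => (h y hy).trans hc,
          h'.overRow_of_forall_lt (fun d hd => lt_of_lt_of_le hc (hr.1 d hd)) ho.2⟩
      · rw [rowInsert_cons_of_le hc] at ho
        exact ⟨ho.1, ih (fun C hC => hR C (by simp [hC])) hr.2 ho.2⟩

end RowAdd

/-! ### Shapes -/

theorem Tab.nil_notMem {U : List (List ℕ)} (h : Tab U) : [] ∉ U := by
  induction U with
  | nil => simp
  | cons R Rs ih =>
    rw [List.mem_cons, not_or]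
    exact ⟨Ne.symm h.1, ih h.2.2.2.2⟩

theorem Tab.over_getD {U : List (List ℕ)} (h : Tab U) (i : ℕ) :
    Over (· < ·) (U.getD i []) (U.getD (i + 1) []) := by
  induction U generalizing i with
  | nil => simp
  | cons R Rs ih =>
    cases i with
    | zero => cases Rs <;> exact h.2.2.2.1
    | succ i => exact ih h.2.2.2.2 i

theorem length_getD_of_map_length {α β : Type*} {T : List (List α)} {U : List (List β)}
    (h : T.map List.length = U.map List.length) (i : ℕ) :
    (T.getD i []).length = (U.getD i []).length := by
  have := congrArg (fun l => l.getD i 0) h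
  simp only [List.getD_eq_getElem?_getD, List.getElem?_map] at this ⊢
  generalize T[i]? = a at this ⊢
  generalize U[i]? = b at this ⊢
  cases a <;> cases b <;> exact this

theorem nil_notMem_of_map_length {α β : Type*} {T : List (List α)} {U : List (List β)}
    (h : T.map List.length = U.map List.length) (hU : [] ∉ U) : [] ∉ T := by
  intro hT
  have : 0 ∈ T.map List.length := List.mem_map.2 ⟨[], hT, rfl⟩
  rw [h] at this
  obtain ⟨R, hR, h0⟩ := List.mem_map.1 this
  exact hU (List.length_eq_zero_iff.1 h0 ▸ hR)

theorem Tab.length_getD_succ_le {U T : List (List ℕ)} (h : Tab U)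
    (hT : T.map List.length = U.map List.length) (i : ℕ) :
    (T.getD (i + 1) []).length ≤ (T.getD i []).length := by
  rw [length_getD_of_map_length hT, length_getD_of_map_length hT]
  exact (h.over_getD i).length_le

/-! ### Skew fillings with zeros in the unfilled boxes -/

/-- Row- and column-strict skew fillings with entries at most `i + c` in the row with index `i`;
the unfilled boxes hold `0`. -/
structure TFill (c : ℕ) (T : List (List ℕ)) : Prop where
  rows : [] ∉ T
  row : ∀ i, (T.getD i []).Pairwise fun a b => a = 0 ∧ b = 0 ∨ a < b
  le : ∀ i, ∀ x ∈ T.getD i [], x ≤ i + c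
  col : ∀ i, Over (fun a b => a = 0 ∨ a < b) (T.getD i []) (T.getD (i + 1) [])

theorem mem_sources {k : ℕ} {T : List (List ℕ)} : k ∈ sources T ↔ k + 1 ∈ T.getD k [] := by
  simp only [sources, List.mem_reverse, List.mem_filter, List.mem_range, decide_eq_true_eq,
    and_iff_right_iff_imp]
  intro h
  by_contra hk
  rw [List.getD_eq_default _ _ (not_lt.1 hk)] at h
  simp at h

theorem sources_pairwise (T : List (List ℕ)) : (sources T).Pairwise (· > ·) := by
  rw [sources, List.pairwise_reverse]
  exact List.pairwise_lt_range.filter _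

theorem eq_of_pairwise_gt {l m : List ℕ} (hl : l.Pairwise (· > ·)) (hm : m.Pairwise (· > ·))
    (h : ∀ x, x ∈ l ↔ x ∈ m) : l = m := by
  have hp : l.Perm m := (List.perm_ext_iff_of_nodup (hl.imp ne_of_gt) (hm.imp ne_of_gt)).2 h
  exact hp.eq_of_pairwise (fun a b _ _ h1 h2 => absurd h1 (not_lt.2 h2.le)) hl hm

theorem sources_appendBox {k : ℕ} {T : List (List ℕ)} (h : ∀ j ∈ sources T, j < k) :
    sources (appendBox (k + 1) k T) = k :: sources T := by
  refine eq_of_pairwise_gt (sources_pairwise _) (List.pairwise_cons.2 ⟨h, sources_pairwise T⟩)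
    fun j => ?_
  rw [mem_sources, getD_appendBox, List.mem_cons, mem_sources]
  split_ifs with hj
  · simp [hj]
  · simp [hj]

/-- As `k` is not yet a source, row `k` has only entries below `k + 1`. The row above has entries at
most `k`, so the column condition holds as well. -/
theorem TFill.fill_appendBox {k : ℕ} {T : List (List ℕ)} (hT : TFill 1 T)
    (hs : ∀ j ∈ sources T, j < k) (h0 : [] ∉ appendBox (k + 1) k T)
    (hl : ∀ i, ((appendBox (k + 1) k T).getD (i + 1) []).length ≤
      ((appendBox (k + 1) k T).getD i []).length) : TFill 1 (appendBox (k + 1) k T) := by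
  have hk : ∀ x ∈ T.getD k [], x < k + 1 := fun x hx => by
    refine lt_of_le_of_ne (hT.le k x hx) ?_
    rintro rfl
    exact lt_irrefl k (hs k (mem_sources.2 hx))
  refine ⟨h0, fun i => ?_, fun i => ?_, fun i => ?_⟩
  · rw [getD_appendBox]
    split_ifs with hi
    · rw [List.pairwise_append]
      refine ⟨hT.row k, by simp, fun a ha b hb => Or.inr ?_⟩
      obtain rfl : b = k + 1 := by simpa using hb
      exact hk a ha
    · exact hT.row i
  · rw [getD_appendBox]
    split_ifs with hi
    · intro x hx
      rcases List.mem_append.1 hx with hx | hx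
      · have := hk x hx
        omega
      · have : x = k + 1 := by simpa using hx
        omega
    · exact hT.le i
  · have hli := hl i
    have hc := hT.col i
    rw [getD_appendBox, getD_appendBox] at hli ⊢
    by_cases h1 : i = k
    · rw [if_pos h1, if_neg (by omega)]
      exact h1 ▸ hc.concat_left
    · by_cases h2 : i + 1 = k
      · rw [if_neg h1, if_pos h2] at hli ⊢
        rw [h2] at hc
        refine hc.concat (by simpa using hli) fun a ha => Or.inr ?_
        have := hT.le i a ha
        omega
      · rw [if_neg h1, if_neg h2]
        exact hc

theorem TFill.of_appendBox {a k : ℕ} {T : List (List ℕ)} (hT : TFill 1 (appendBox a k T))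
    (h0 : [] ∉ T) (hl : ∀ i, (T.getD (i + 1) []).length ≤ (T.getD i []).length) : TFill 1 T := by
  refine ⟨h0, fun i => ?_, fun i => ?_, fun i => ?_⟩
  · have h := hT.row i
    rw [getD_appendBox] at h
    split_ifs at h with hi
    · exact hi ▸ (List.pairwise_append.1 h).1
    · exact h
  · have h := hT.le i
    rw [getD_appendBox] at h
    split_ifs at h with hi
    · exact fun x hx => h x (List.mem_append_left _ (hi ▸ hx))
    · exact h
  · have h := hT.col i
    rw [getD_appendBox, getD_appendBox] at h
    by_cases h1 : i = k
    · rw [if_pos h1, if_neg (by omega)] at h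
      subst h1
      exact h.of_concat_left (hl i)
    · by_cases h2 : i + 1 = k
      · rw [if_neg h1, if_pos h2] at h
        subst h2
        exact h.of_concat
      · rwa [if_neg h1, if_neg h2] at h

theorem Over.last {α β : Type*} {r : α → β → Prop} {a : α} {b : β} : ∀ {l : List α} {m : List β},
    Over r (l ++ [a]) (m ++ [b]) → l.length = m.length → r a b
  | [], [], h, _ => h.1
  | [], _ :: _, _, h => by simp at h
  | _ :: _, [], _, h => by simp at h
  | _ :: _, _ :: _, h, h' => h.2.last (Nat.succ_injective h')

/-- If the box was alone in its row, the row disappears; it is restored at the same index only if it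
was the last one. -/
theorem appendBox_removeBox {a k : ℕ} {L : List ℕ} {T : List (List ℕ)}
    (hk : T.getD k [] = L ++ [a]) (h : L = [] → T.length ≤ k + 1) :
    appendBox a k (removeBox k T) = T := by
  induction T generalizing k with
  | nil => simp at hk
  | cons R T ih =>
    cases k with
    | zero =>
      obtain rfl : R = L ++ [a] := by simpa using hk
      cases L with
      | nil =>
        obtain rfl : T = [] := by simpa using h rfl
        simp [removeBox, appendBox]
      | cons b L =>
        have e : (b :: L ++ [a]).dropLast = b :: L := List.dropLast_concat
        rw [removeBox, if_neg (by simp), e, appendBox]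
    | succ k =>
      rw [removeBox, appendBox, ih (by simpa using hk) (by simpa using h)]

theorem length_le_of_getD_eq_nil {α : Type*} {T : List (List α)} (hT : [] ∉ T) {i : ℕ}
    (h : T.getD i [] = []) : T.length ≤ i := by
  by_contra hi
  rw [List.getD_eq_getElem _ _ (not_le.1 hi)] at h
  exact hT (h ▸ List.getElem_mem _)

/-- The lowest box with maximal entry is a corner at the end of its row. -/
theorem TFill.corner {k : ℕ} {ks : List ℕ} {T : List (List ℕ)} (hT : TFill 1 T)
    (hs : sources T = k :: ks) :
    (T.getD (k + 1) []).length < (T.getD k []).length ∧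
      appendBox (k + 1) k (removeBox k T) = T := by
  have hmem : k + 1 ∈ T.getD k [] := mem_sources.1 (by simp [hs])
  rcases List.eq_nil_or_concat (T.getD k []) with h | ⟨L, b, h⟩
  · rw [h] at hmem
    simp at hmem
  rw [List.concat_eq_append] at h
  have hrow := hT.row k
  have hle := hT.le k
  rw [h] at hmem hrow hle
  obtain rfl : b = k + 1 := by
    rcases List.mem_append.1 hmem with hm | hm
    · have h1 := (List.pairwise_append.1 hrow).2.2 _ hm b (by simp)
      have h2 := hle b (by simp)
      omega
    · exact (List.mem_singleton.1 hm).symm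
  have hcorner : (T.getD (k + 1) []).length < (T.getD k []).length := by
    -- If the next row were equally long, its last entry would exceed `k + 1` and be at most `k +
    -- 2`. Then `k + 1` would be a source below the lowest source `k`.
    have hc := hT.col k
    refine lt_of_le_of_ne hc.length_le fun hlen => ?_
    rcases List.eq_nil_or_concat (T.getD (k + 1) []) with h' | ⟨M, c, h'⟩
    · rw [h, h'] at hlen
      simp at hlen
    · rw [List.concat_eq_append] at h'
      rw [h, h'] at hlen hc
      have h1 := hc.last (by simpa using hlen.symm)
      have h2 := hT.le (k + 1) c (by rw [h']; simp)
      obtain rfl : c = k + 1 + 1 := by omega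
      have h3 : k + 1 ∈ sources T := mem_sources.2 (by rw [h']; simp)
      have h4 := sources_pairwise T
      rw [hs] at h3 h4
      rcases List.mem_cons.1 h3 with h3 | h3
      · omega
      · have := (List.pairwise_cons.1 h4).1 _ h3
        omega
  refine ⟨hcorner, appendBox_removeBox h ?_⟩
  rintro rfl
  refine length_le_of_getD_eq_nil hT.rows ?_
  rw [h] at hcorner
  exact List.length_eq_zero_iff.1 (by simpa using hcorner)

/-! ### Single steps -/

/-- The pair `(T, U)` below the row `R` while this row is treated. -/
structure Inv (R : List (Finset ℕ)) (p : List (List ℕ) × List (List ℕ)) : Prop where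
  row : RowOK R
  overRow : OverRow R (p.2.headD [])
  tab : Tab p.2
  fill : TFill 1 p.1
  shape : p.1.map List.length = p.2.map List.length
  -- The next number to leave `R` will create its box below all boxes recorded for `R` so far; this
  -- ties the order of `sources` to the order of insertion.
  lt : ∀ x xs, extrasRow R = x :: xs → ∀ k ∈ sources p.1, k < (rskInsert x p.2).2

theorem Inv.exists_uncrowdNumber {R : List (Finset ℕ)} {p : List (List ℕ) × List (List ℕ)} {x : ℕ}
    {xs : List ℕ} (h : Inv R p) (he : extrasRow R = x :: xs) :
    ∃ R' k, Inv R' (uncrowdNumber p x) ∧ extrasRow R' = xs ∧ R'.map boxMin = R.map boxMin ∧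
      sources (uncrowdNumber p x).1 = k :: sources p.1 ∧
      crowdStep (R', uncrowdNumber p x) k = (R, p) := by
  obtain ⟨R', hadd, hxs⟩ := RowAdd.exists_left h.row he
  have hR' := hadd.rowOK_left h.row
  have hx : 0 < x := by
    obtain ⟨B, hB, hxB⟩ := hadd.exists_self_mem
    exact h.row.pos B hB x hxB
  have hshape := map_length_appendBox ((rskInsert x p.2).2 + 1) x h.shape
  have htab := h.tab.rskInsert hx
  have hlt := h.lt x xs he
  have hsrc := sources_appendBox hlt
  have hpw := h.row.extrasRow_pairwise
  rw [he, List.pairwise_cons] at hpw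
  refine ⟨R', (rskInsert x p.2).2, ⟨hR', ?_, htab, ?_, hshape, ?_⟩, hxs,
    (hadd.map_boxMin hR'.nonempty).symm, hsrc, ?_⟩
  · simp only [uncrowdNumber, headD_rskInsert]
    exact hadd.overRow_rowInsert h.overRow
  · exact h.fill.fill_appendBox hlt (nil_notMem_of_map_length hshape htab.nil_notMem)
      (htab.length_getD_succ_le hshape)
  · intro x' xs' he' k hk
    -- The extras decrease strictly, so the next box lies below the box just made, which lies below
    -- all earlier ones.
    have hx' : x' < x := hpw.1 x' (by simp [← hxs, he'])
    have hb := lt_rskInsert_rskInsert hx' h.tab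
    simp only [uncrowdNumber, hsrc] at hk
    rcases List.mem_cons.1 hk with rfl | hk
    exacts [hb, (hlt k hk).trans hb]
  · have hk : (rskInsert x p.2).2 ≤ p.1.length := by
      have := congrArg List.length h.shape
      simp only [List.length_map] at this
      exact this ▸ snd_rskInsert_le x p.2
    simp only [crowdStep, uncrowdNumber, rskDelete_rskInsert x h.tab,
      removeBox_appendBox _ h.fill.rows hk, hadd.crowdNumber_eq hR'.nonempty]

theorem Inv.exists_crowdStep {R : List (Finset ℕ)} {p : List (List ℕ) × List (List ℕ)} {k : ℕ}
    {ks : List ℕ} (h : Inv R p) (hs : sources p.1 = k :: ks) :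
    ∃ R' q x, crowdStep (R, p) k = (R', q) ∧ Inv R' q ∧ extrasRow R' = x :: extrasRow R ∧
      R'.map boxMin = R.map boxMin ∧ sources q.1 = ks ∧ uncrowdNumber q x = p := by
  obtain ⟨T, U⟩ := p
  obtain ⟨hcorner, happ⟩ := h.fill.corner hs
  simp only at hs
  rw [length_getD_of_map_length h.shape, length_getD_of_map_length h.shape] at hcorner
  obtain ⟨htab, hins, hmem⟩ := rskInsert_rskDelete h.tab hcorner
  have hshape := map_length_removeBox k h.shape
  simp only at happ htab hins hmem hshape
  have hpos : 0 < (rskDelete k U).2 := by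
    cases U with
    | nil => simp at hmem
    | cons S U => exact h.tab.2.2.1 _ hmem
  set U' := (rskDelete k U).1
  set x := (rskDelete k U).2
  set T' := removeBox k T
  have hover : OverRow R (rowInsert x (U'.headD [])).1 := by
    rw [← headD_rskInsert, hins]
    exact h.overRow
  have hlt : ∀ e ∈ extrasRow R, e < x := by
    cases he : extrasRow R with
    | nil => simp
    | cons z zs =>
      have hz : z < x := by
        -- If `x ≤ z`, then putting `x` back and inserting `z` afterwards would end in row `k` or
        -- above, against `Inv.lt` for the source `k`.
        by_contra hz
        have h1 := rskInsert_rskInsert_le (not_lt.1 hz) htab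
        rw [hins] at h1
        exact absurd (h.lt z zs he k (by simp [hs])) (not_lt.2 h1)
      have hpw := h.row.extrasRow_pairwise
      rw [he, List.pairwise_cons] at hpw
      intro e hm
      rcases List.mem_cons.1 hm with rfl | hm
      exacts [hz, (hpw.1 e hm).trans hz]
  have hhead : ∃ y ∈ R.headD ∅, y < x := by
    obtain ⟨a, r, e, ha⟩ := exists_rowInsert_eq_cons x (U'.headD [])
    rw [e] at hover
    cases hR : R with
    | nil => rw [hR] at hover; exact hover.elim
    | cons B Bs =>
      rw [hR] at hover
      obtain ⟨y, hy⟩ := h.row.nonempty B (by simp [hR])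
      exact ⟨y, hy, lt_of_lt_of_le (hover.1 y hy) ha⟩
  obtain ⟨R', hadd⟩ := RowAdd.exists_right h.row hhead hlt
  have hfill : TFill 1 T' := by
    refine TFill.of_appendBox (a := k + 1) (k := k) ?_
      (nil_notMem_of_map_length hshape htab.nil_notMem) (htab.length_getD_succ_le hshape)
    rw [happ]
    exact h.fill
  have hsrc : ∀ j ∈ sources T', j < k := by
    intro j hj
    rw [mem_sources] at hj
    have hrow := h.fill.row k
    have hj' : j ∈ sources T := by
      rw [mem_sources, ← happ, getD_appendBox]
      split_ifs with hjk
      · exact List.mem_append_left _ (hjk ▸ hj)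
      · exact hj
    simp only at hrow
    rw [← happ, getD_appendBox, if_pos rfl] at hrow
    have hpw := sources_pairwise T
    rw [hs] at hj' hpw
    rcases List.mem_cons.1 hj' with rfl | hj'
    -- Row `k` cannot hold its maximal entry twice, so `k` is no longer a source.
    · have := (List.pairwise_append.1 hrow).2.2 _ hj (j + 1) (by simp)
      omega
    · exact (List.pairwise_cons.1 hpw).1 j hj'
  have hks : sources T' = ks := by
    have := sources_appendBox hsrc
    rw [happ, hs, List.cons.injEq] at this
    exact this.2.symm
  have hext := hadd.extrasRow_eq h.row hlt
  refine ⟨R', (T', U'), x, ?_, ⟨hadd.rowOK hpos h.row, ?_, htab, hfill, hshape, ?_⟩, hext,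
    hadd.map_boxMin h.row.nonempty, hks, ?_⟩
  · simp only [crowdStep, Prod.mk.injEq]
    refine ⟨?_, rfl, rfl⟩
    exact hadd.crowdNumber_eq h.row.nonempty
  · exact hadd.overRow_of_rowInsert h.row.nonempty htab.headD_sorted hover
  · intro z zs he j hj
    rw [hext, List.cons.injEq] at he
    rw [← he.1]
    simp only at hj ⊢
    rw [hins]
    exact hsrc j hj
  · simp only [uncrowdNumber, hins, happ]

/-! ### Treating one row -/

theorem TFill.mono {c d : ℕ} (hcd : c ≤ d) {T : List (List ℕ)} (h : TFill c T) : TFill d T :=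
  ⟨h.rows, h.row, fun i x hx => (h.le i x hx).trans (by omega), h.col⟩

theorem TFill.sources_eq_nil {T : List (List ℕ)} (h : TFill 0 T) : sources T = [] := by
  refine List.eq_nil_iff_forall_not_mem.2 fun k hk => ?_
  have := h.le k _ (mem_sources.1 hk)
  omega

theorem TFill.zero_of_sources {T : List (List ℕ)} (h : TFill 1 T) (hs : sources T = []) :
    TFill 0 T := by
  refine ⟨h.rows, h.row, fun i x hx => ?_, h.col⟩
  have h1 := h.le i x hx
  have h2 : x ≠ i + 1 := by
    rintro rfl
    have := mem_sources.2 hx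
    simp [hs] at this
  omega

/-- The last claim allows sources in `p.1` for the sake of the induction. If there are none, its
right side is `(R, p)`, so crowding undoes the treatment of the row. -/
theorem Inv.foldl_uncrowdNumber {R : List (Finset ℕ)} {p : List (List ℕ) × List (List ℕ)}
    (h : Inv R p) :
    ∃ R', Inv R' ((extrasRow R).foldl uncrowdNumber p) ∧ extrasRow R' = [] ∧
      R'.map boxMin = R.map boxMin ∧
      (sources ((extrasRow R).foldl uncrowdNumber p).1).foldl crowdStep
        (R', (extrasRow R).foldl uncrowdNumber p) = (sources p.1).foldl crowdStep (R, p) := by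
  generalize he : extrasRow R = xs
  induction xs generalizing R p with
  | nil => exact ⟨R, h, he, rfl, rfl⟩
  | cons x xs ih =>
    obtain ⟨R₁, k, h1, h2, h3, h4, h5⟩ := h.exists_uncrowdNumber he
    obtain ⟨R', i1, i2, i3, i4⟩ := ih h1 h2
    refine ⟨R', i1, i2, i3.trans h3, ?_⟩
    rw [List.foldl_cons, i4, h4, List.foldl_cons, h5]

/-- For a row of singletons, without extras, the right side of the last equation is `p`. -/
theorem Inv.foldl_crowdStep {R : List (Finset ℕ)} {p : List (List ℕ) × List (List ℕ)}
    (h : Inv R p) :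
    ∃ R' q, (sources p.1).foldl crowdStep (R, p) = (R', q) ∧ Inv R' q ∧ sources q.1 = [] ∧
      R'.map boxMin = R.map boxMin ∧
      (extrasRow R').foldl uncrowdNumber q = (extrasRow R).foldl uncrowdNumber p := by
  generalize hs : sources p.1 = ks
  induction ks generalizing R p with
  | nil => exact ⟨R, p, rfl, h, hs, rfl, rfl⟩
  | cons k ks ih =>
    obtain ⟨R₁, q, x, h1, h2, h3, h4, h5, h6⟩ := h.exists_crowdStep hs
    obtain ⟨R', q', i1, i2, i3, i4, i5⟩ := ih h2 h5
    refine ⟨R', q', ?_, i2, i3, i4.trans h4, ?_⟩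
    · rw [List.foldl_cons, h1, i1]
    · rw [i5, h3, List.foldl_cons, h6]

theorem length_le_foldl_uncrowdNumber (xs : List ℕ) (p : List (List ℕ) × List (List ℕ)) :
    p.2.length ≤ (xs.foldl uncrowdNumber p).2.length := by
  induction xs generalizing p with
  | nil => exact le_rfl
  | cons x xs ih => exact (length_le_rskInsert x p.2).trans (ih (uncrowdNumber p x))

/-- Recorded entries are positive, so the zeros keep marking the original shape. -/
theorem count_zero_foldl_uncrowdNumber (xs : List ℕ) (p : List (List ℕ) × List (List ℕ)) (i : ℕ) :
    ((xs.foldl uncrowdNumber p).1.getD i []).count 0 = (p.1.getD i []).count 0 := by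
  induction xs generalizing p with
  | nil => rfl
  | cons x xs ih =>
    rw [List.foldl_cons, ih, uncrowdNumber, getD_appendBox]
    split_ifs with h
    · rw [h]
      simp
    · rfl

theorem count_foldl_uncrowdNumber (v : ℕ) (xs : List ℕ) (p : List (List ℕ) × List (List ℕ)) :
    weight (xs.foldl uncrowdNumber p).2 v = xs.count v + weight p.2 v := by
  induction xs generalizing p with
  | nil => simp
  | cons x xs ih =>
    rw [List.foldl_cons, ih, weight, uncrowdNumber, (flatten_rskInsert_perm x p.2).count_eq,
      List.count_cons, List.count_cons, weight]
    omega

theorem skewSize_foldl_uncrowdNumber (xs : List ℕ) (p : List (List ℕ) × List (List ℕ)) :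
    skewSize (xs.foldl uncrowdNumber p).1 = xs.length + skewSize p.1 := by
  induction xs generalizing p with
  | nil => simp
  | cons x xs ih =>
    rw [List.foldl_cons, ih, skewSize, uncrowdNumber, (flatten_appendBox_perm _ _ p.1).countP_eq,
      List.countP_cons_of_pos (by simp), List.length_cons, skewSize]
    omega

/-! ### Treating all rows -/

/-- Set-valued tableaux as lists of rows. -/
def SV : List (List (Finset ℕ)) → Prop
  | [] => True
  | R :: Rs => R ≠ [] ∧ RowOK R ∧ OverRow R ((Rs.headD []).map boxMin) ∧ SV Rs

/-- A new top row raises every row index by one, which absorbs the constant `1`. -/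
theorem TFill.cons {S : List ℕ} {T : List (List ℕ)} (h : TFill 1 T) (hS : S ≠ [])
    (h0 : ∀ x ∈ S, x = 0) (hl : (T.headD []).length ≤ S.length) : TFill 0 (S :: T) := by
  refine ⟨?_, fun i => ?_, fun i => ?_, fun i => ?_⟩
  · rw [List.mem_cons, not_or]
    exact ⟨Ne.symm hS, h.rows⟩
  · cases i with
    | zero =>
      exact List.pairwise_of_forall_mem_list fun a ha b hb => Or.inl ⟨h0 a ha, h0 b hb⟩
    | succ i => exact h.row i
  · cases i with
    | zero => exact fun x hx => (h0 x hx).le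
    | succ i => exact fun x hx => (h.le i x hx).trans (by omega)
  · cases i with
    | zero =>
      refine over_of_length ?_ fun a ha b _ => Or.inl (h0 a ha)
      cases T <;> exact hl
    | succ i => exact h.col i

theorem TFill.of_cons {S : List ℕ} {T : List (List ℕ)} (h : TFill 0 (S :: T)) :
    (∀ x ∈ S, x = 0) ∧ TFill 1 T :=
  ⟨fun x hx => Nat.le_zero.1 (h.le 0 x hx), fun hT => h.rows (List.mem_cons_of_mem _ hT),
    fun i => h.row (i + 1), fun i x hx => (h.le (i + 1) x hx).trans (by omega),
    fun i => h.col (i + 1)⟩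

/-- Pairs of a skew filling and a semistandard tableau of the same shape. -/
structure LPair (p : List (List ℕ) × List (List ℕ)) : Prop where
  tab : Tab p.2
  fill : TFill 0 p.1
  shape : p.1.map List.length = p.2.map List.length

theorem uncrowd_cons (R : List (Finset ℕ)) (Rs : List (List (Finset ℕ))) :
    uncrowd (R :: Rs) = (R.map (fun _ => 0) :: ((extrasRow R).foldl uncrowdNumber (uncrowd Rs)).1,
      R.map boxMin :: ((extrasRow R).foldl uncrowdNumber (uncrowd Rs)).2) := rfl

theorem headD_uncrowd (F : List (List (Finset ℕ))) :
    (uncrowd F).2.headD [] = (F.headD []).map boxMin := by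
  cases F <;> rfl

theorem count_zero_uncrowd (F : List (List (Finset ℕ))) (i : ℕ) :
    ((uncrowd F).1.getD i []).count 0 = (F.getD i []).length := by
  induction F generalizing i with
  | nil => simp [uncrowd]
  | cons R Rs ih =>
    rw [uncrowd_cons]
    cases i with
    | zero => simp
    | succ i => simpa only [List.getD_cons_succ, count_zero_foldl_uncrowdNumber] using ih i

theorem RowOK.map_boxMin_sorted {R : List (Finset ℕ)} (h : RowOK R) :
    (R.map boxMin).Pairwise (· ≤ ·) := by
  rw [List.pairwise_map]
  exact h.weak.imp_of_mem fun ha hb hab =>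
    hab _ (boxMin_mem (h.nonempty _ ha)) _ (boxMin_mem (h.nonempty _ hb))

theorem OverRow.map_boxMin {R : List (Finset ℕ)} {r : List ℕ} (hR : ∀ B ∈ R, B.Nonempty)
    (h : OverRow R r) : Over (· < ·) (R.map boxMin) r :=
  over_map_left.2 (h.imp fun B hB _ _ hc => hc _ (boxMin_mem (hR B hB)))

/-- The counter `n` may be any large enough number, because crowding a row can shorten the tableau
below, so its exact length does not survive the induction. -/
theorem uncrowd_spec {F : List (List (Finset ℕ))} (hF : SV F) :
    LPair (uncrowd F) ∧
      ∀ n, (uncrowd F).2.length ≤ n → crowdRows n (uncrowd F).1 (uncrowd F).2 = F := by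
  induction F with
  | nil =>
    refine ⟨⟨trivial, ⟨by simp [uncrowd], ?_, ?_, ?_⟩, rfl⟩, fun n _ => ?_⟩
    · simp [uncrowd]
    · simp [uncrowd]
    · simp [uncrowd]
    · cases n <;> rfl
  | cons R Rs ih =>
    obtain ⟨h1, h2, h3, h4⟩ := hF
    obtain ⟨hp, hinv⟩ := ih h4
    have hI : Inv R (uncrowd Rs) := by
      refine ⟨h2, ?_, hp.tab, hp.fill.mono zero_le_one, hp.shape, ?_⟩
      · rw [headD_uncrowd]
        exact h3
      · intro x xs _ k hk
        simp [hp.fill.sources_eq_nil] at hk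
    obtain ⟨R', i1, i2, i3, i4⟩ := hI.foldl_uncrowdNumber
    have hlen := length_le_foldl_uncrowdNumber (extrasRow R) (uncrowd Rs)
    rw [uncrowd_cons]
    generalize (extrasRow R).foldl uncrowdNumber (uncrowd Rs) = q at *
    have hRR' : R'.length = R.length := by simpa using congrArg List.length i3
    refine ⟨⟨⟨by simpa using h1, h2.map_boxMin_sorted, ?_, ?_, i1.tab⟩, ?_, ?_⟩, fun n hn => ?_⟩
    · intro x hx
      obtain ⟨B, hB, rfl⟩ := List.mem_map.1 hx
      exact h2.pos B hB _ (boxMin_mem (h2.nonempty B hB))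
    · rw [← i3]
      exact i1.overRow.map_boxMin i1.row.nonempty
    · refine i1.fill.cons (by simpa using h1) (by simp) ?_
      have hl := i1.overRow.length_le
      have hl' := length_getD_of_map_length i1.shape 0
      rw [List.length_map, ← hRR']
      refine le_trans (le_of_eq ?_) hl
      rw [List.headD_eq_head?_getD, List.headD_eq_head?_getD, List.head?_eq_getElem?,
        List.head?_eq_getElem?, ← List.getD_eq_getElem?_getD, ← List.getD_eq_getElem?_getD, hl']
    · simp [i1.shape]
    · cases n with
      | zero => simp at hn
      | succ n =>
        -- The row without extras is the row of singletons from which `crowdRows` starts.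
        have hs := eq_singletons_of_extrasRow i1.row.nonempty i2
        rw [i3] at hs
        rw [crowdRows, ← hs, i4, hp.fill.sources_eq_nil, List.foldl_nil]
        simp only [List.cons.injEq, true_and]
        exact hinv n (hlen.trans (Nat.le_of_succ_le_succ hn))

theorem rowOK_singletons {R : List ℕ} (hR : R.Pairwise (· ≤ ·)) (hpos : ∀ x ∈ R, 0 < x) :
    RowOK (R.map fun x => {x}) := by
  refine ⟨by simp, by simpa using hpos, ?_⟩
  rw [List.pairwise_map]
  exact hR.imp (by simp)

theorem extrasRow_singletons (R : List ℕ) : extrasRow (R.map fun x => {x}) = [] := by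
  induction R with
  | nil => rfl
  | cons x R ih => simp [ih]

theorem crowdRows_spec {n : ℕ} {p : List (List ℕ) × List (List ℕ)} (hp : LPair p)
    (hn : p.2.length ≤ n) :
    SV (crowdRows n p.1 p.2) ∧ uncrowd (crowdRows n p.1 p.2) = p := by
  induction n generalizing p with
  | zero =>
    obtain ⟨T, U⟩ := p
    obtain rfl : U = [] := by simpa using hn
    obtain rfl : T = [] := by simpa using hp.shape
    exact ⟨trivial, rfl⟩
  | succ n ih =>
    obtain ⟨T, U⟩ := p
    cases U with
    | nil =>
      obtain rfl : T = [] := by simpa using hp.shape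
      exact ⟨trivial, rfl⟩
    | cons R U =>
      cases T with
      | nil => simpa using hp.shape
      | cons S T =>
        obtain ⟨⟨h1, h2, h3, h4, h5⟩, hfill, hshape⟩ := hp
        obtain ⟨hS, hfill⟩ := TFill.of_cons hfill
        simp only [List.map_cons, List.cons.injEq] at hshape
        have hI : Inv (R.map fun x => {x}) (T, U) := by
          refine ⟨rowOK_singletons h2 h3, ?_, h5, hfill, hshape.2, ?_⟩
          · exact over_map_left.2 (h4.imp (by simp))
          · simp [extrasRow_singletons]
        obtain ⟨R', q, i1, i2, i3, i4, i5⟩ := hI.foldl_crowdStep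
        rw [extrasRow_singletons, List.foldl_nil] at i5
        -- With the sources used up, no entry attains the bound `i + 1`, so the pair below is again
        -- of the kind covered by the induction hypothesis.
        have hq : LPair q := ⟨i2.tab, i2.fill.zero_of_sources i3, i2.shape⟩
        have hlen := length_le_foldl_uncrowdNumber (extrasRow R') q
        rw [i5] at hlen
        obtain ⟨j1, j2⟩ := ih hq (hlen.trans (Nat.le_of_succ_le_succ hn))
        have hmin : R'.map boxMin = R := by
          rw [i4, List.map_map]
          exact (List.map_congr_left fun x _ => boxMin_singleton x).trans R.map_id
        simp only [crowdRows, i1]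
        refine ⟨⟨?_, i2.row, ?_, j1⟩, ?_⟩
        · rintro rfl
          exact h1 hmin.symm
        · rw [← headD_uncrowd, j2]
          exact i2.overRow
        · rw [uncrowd_cons, j2, i5, hmin]
          have hRl : R'.length = R.length := by simpa using congrArg List.length hmin
          have : R'.map (fun _ => 0) = S := by
            rw [List.map_const', hRl, ← hshape.1]
            exact (List.eq_replicate_iff.2 ⟨rfl, hS⟩).symm
          rw [this]

/-! ### Weights of a tableau and its image -/

theorem count_boxMin_add_count_extrasRow (v : ℕ) {R : List (Finset ℕ)}
    (hR : ∀ B ∈ R, B.Nonempty) :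
    (R.map boxMin).count v + (extrasRow R).count v = R.countP (fun B => v ∈ B) := by
  induction R with
  | nil => rfl
  | cons B Bs ih =>
    have hB : (extras B).count v + [boxMin B].count v = if v ∈ B then 1 else 0 := by
      rw [← List.count_append, extras_append_boxMin (hR B (by simp)),
        List.Nodup.count (Finset.sort_nodup _ _)]
      simp
    have := ih fun C hC => hR C (by simp [hC])
    rw [extrasRow_cons, List.count_append, List.countP_cons, List.map_cons, ← List.singleton_append,
      List.count_append]
    simp only [decide_eq_true_eq]
    omega

theorem length_add_length_extrasRow {R : List (Finset ℕ)} (hR : ∀ B ∈ R, B.Nonempty) :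
    R.length + (extrasRow R).length = (R.map Finset.card).sum := by
  induction R with
  | nil => rfl
  | cons B Bs ih =>
    have hB := congrArg List.length (extras_append_boxMin (hR B (by simp)))
    have := ih fun C hC => hR C (by simp [hC])
    simp only [List.length_append, List.length_singleton, Finset.length_sort] at hB
    simp only [extrasRow_cons, List.length_append, List.length_cons, List.map_cons, List.sum_cons]
    omega

theorem weight_uncrowd (v : ℕ) {F : List (List (Finset ℕ))} (hF : SV F) :
    weight (uncrowd F).2 v = setWeight F v := by
  induction F with
  | nil => rfl
  | cons R Rs ih =>
    have h1 := count_foldl_uncrowdNumber v (extrasRow R) (uncrowd Rs)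
    have h2 := count_boxMin_add_count_extrasRow v hF.2.1.nonempty
    have h3 := ih hF.2.2.2
    rw [uncrowd_cons, weight, setWeight, List.flatten_cons, List.flatten_cons, List.count_append,
      List.countP_append]
    rw [weight] at h1
    rw [setWeight] at h3
    omega

theorem skewSize_uncrowd {F : List (List (Finset ℕ))} (hF : SV F) :
    skewSize (uncrowd F).1 + (F.map List.length).sum = setSize F := by
  induction F with
  | nil => rfl
  | cons R Rs ih =>
    have h1 := skewSize_foldl_uncrowdNumber (extrasRow R) (uncrowd Rs)
    have h2 := length_add_length_extrasRow hF.2.1.nonempty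
    have h3 := ih hF.2.2.2
    have h4 : (R.map fun _ => 0).countP (fun t => 0 < t) = 0 := by simp
    rw [uncrowd_cons, skewSize, setSize, List.flatten_cons, List.flatten_cons, List.countP_append,
      h4, List.map_cons, List.sum_cons, List.map_append, List.sum_append]
    rw [skewSize] at h1
    rw [setSize] at h3
    omega

/-! ### Comparison with the entrywise definitions -/

section Lists

variable {α : Type*}

theorem forall_mem_iff_getD (d : α) {l : List α} {P : α → Prop} :
    (∀ x ∈ l, P x) ↔ ∀ j < l.length, P (l.getD j d) := by
  rw [List.forall_mem_iff_getElem]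
  refine forall₂_congr fun j hj => ?_
  rw [List.getD_eq_getElem _ _ hj]

theorem pairwise_iff_getD (d : α) {l : List α} {r : α → α → Prop} :
    l.Pairwise r ↔ ∀ i j, i < j → j < l.length → r (l.getD i d) (l.getD j d) := by
  rw [List.pairwise_iff_getElem]
  refine ⟨fun h i j hij hj => ?_, fun h i j hi hj hij => ?_⟩
  · rw [List.getD_eq_getElem _ _ (hij.trans hj), List.getD_eq_getElem _ _ hj]
    exact h i j _ _ hij
  · have := h i j hij hj
    rwa [List.getD_eq_getElem _ _ hi, List.getD_eq_getElem _ _ hj] at this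

end Lists

/-! ### Row lengths of Young diagrams and of fillings. -/

theorem getD_rowLens (μ : YoungDiagram) (i : ℕ) : μ.rowLens.getD i 0 = μ.rowLen i := by
  rcases lt_or_ge i μ.rowLens.length with h | h
  · rw [List.getD_eq_getElem _ _ h, YoungDiagram.get_rowLens]
  · rw [List.getD_eq_default _ _ h]
    rw [YoungDiagram.length_rowLens] at h
    by_contra h0
    have : (i, 0) ∈ μ := YoungDiagram.mem_iff_lt_rowLen.2 (Nat.pos_of_ne_zero (Ne.symm h0))
    exact absurd (YoungDiagram.mem_iff_lt_colLen.1 this) (not_lt.2 h)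

theorem getD_map_length {α : Type*} (F : List (List α)) (i : ℕ) :
    (F.map List.length).getD i 0 = (F.getD i []).length := by
  simp only [List.getD_eq_getElem?_getD, List.getElem?_map]
  generalize F[i]? = a
  cases a <;> rfl

theorem hasShape_iff {α : Type*} {μ : YoungDiagram} {F : List (List α)} :
    HasShape μ F ↔ [] ∉ F ∧ ∀ i, (F.getD i []).length = μ.rowLen i := by
  constructor
  · intro h
    refine ⟨fun h0 => ?_, fun i => ?_⟩
    · exact absurd (YoungDiagram.pos_of_mem_rowLens μ 0 (h ▸ List.mem_map.2 ⟨[], h0, rfl⟩))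
        (lt_irrefl 0)
    · rw [← getD_map_length, show F.map List.length = μ.rowLens from h, getD_rowLens]
  · rintro ⟨h0, h⟩
    have hlen (i : ℕ) : i < F.length ↔ i < μ.rowLens.length := by
      rw [YoungDiagram.length_rowLens, ← YoungDiagram.mem_iff_lt_colLen,
        YoungDiagram.mem_iff_lt_rowLen, ← h]
      constructor
      · intro hi
        rw [List.length_pos_iff]
        exact fun hn => absurd (length_le_of_getD_eq_nil h0 hn) (not_le.2 hi)
      · intro hi
        by_contra hn
        rw [List.getD_eq_default _ _ (not_lt.1 hn)] at hi
        exact lt_irrefl 0 hi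
    have hl : (F.map List.length).length = μ.rowLens.length := by
      rw [List.length_map]
      exact le_antisymm (not_lt.1 fun h => lt_irrefl _ ((hlen _).1 h))
        (not_lt.1 fun h => lt_irrefl _ ((hlen _).2 h))
    refine List.ext_getElem hl fun i h1 h2 => ?_
    have := getD_map_length F i
    rwa [h, ← getD_rowLens, List.getD_eq_getElem _ _ h1, List.getD_eq_getElem _ _ h2] at this

theorem HasShape.mem_iff {α : Type*} {μ : YoungDiagram} {F : List (List α)} (h : HasShape μ F)
    {i j : ℕ} : (i, j) ∈ μ ↔ j < (F.getD i []).length := by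
  rw [(hasShape_iff.1 h).2, YoungDiagram.mem_iff_lt_rowLen]

/-- A transitive relation between the boxes of a column follows from the case of neighbours. -/
theorem column_induction {μ : YoungDiagram} {j : ℕ} {P : ℕ → ℕ → Prop}
    (step : ∀ i, (i + 1, j) ∈ μ → P i (i + 1))
    (trans : ∀ a b, (b, j) ∈ μ → P a b → P b (b + 1) → P a (b + 1)) {a b : ℕ} (hab : a < b)
    (hb : (b, j) ∈ μ) : P a b := by
  induction b, hab using Nat.le_induction with
  | base => exact step a hb
  | succ b hab ih =>
    have hb' : (b, j) ∈ μ := μ.up_left_mem (Nat.le_succ b) le_rfl hb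
    exact trans a b hb' (ih hb') (step b hb)

theorem rowOK_nil : RowOK [] := ⟨by simp, by simp, List.Pairwise.nil⟩

theorem sv_iff {F : List (List (Finset ℕ))} : SV F ↔ [] ∉ F ∧ (∀ i, RowOK (F.getD i [])) ∧
    ∀ i, OverRow (F.getD i []) ((F.getD (i + 1) []).map boxMin) := by
  induction F with
  | nil => simp [SV, rowOK_nil, OverRow]
  | cons R Rs ih =>
    have hd : Rs.headD [] = Rs.getD 0 [] := by cases Rs <;> rfl
    rw [SV, ih, hd, List.mem_cons, not_or]
    constructor
    · rintro ⟨h1, h2, h3, h4, h5, h6⟩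
      refine ⟨⟨Ne.symm h1, h4⟩, fun i => ?_, fun i => ?_⟩
      · cases i
        exacts [h2, h5 _]
      · cases i
        exacts [h3, h6 _]
    · rintro ⟨⟨h1, h2⟩, h3, h4⟩
      exact ⟨Ne.symm h1, h3 0, h4 0, h2, fun i => h3 (i + 1), fun i => h4 (i + 1)⟩

theorem tab_iff {U : List (List ℕ)} : Tab U ↔ [] ∉ U ∧ (∀ i, (U.getD i []).Pairwise (· ≤ ·)) ∧
    (∀ i, ∀ x ∈ U.getD i [], 0 < x) ∧ ∀ i, Over (· < ·) (U.getD i []) (U.getD (i + 1) []) := by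
  induction U with
  | nil => simp [Tab]
  | cons R Rs ih =>
    have hd : Rs.headD [] = Rs.getD 0 [] := by cases Rs <;> rfl
    rw [Tab, ih, hd, List.mem_cons, not_or]
    constructor
    · rintro ⟨h1, h2, h3, h4, h5, h6, h7, h8⟩
      refine ⟨⟨Ne.symm h1, h5⟩, fun i => ?_, fun i => ?_, fun i => ?_⟩
      · cases i
        exacts [h2, h6 _]
      · cases i
        exacts [h3, h7 _]
      · cases i
        exacts [h4, h8 _]
    · rintro ⟨⟨h1, h2⟩, h3, h4, h5⟩
      exact ⟨Ne.symm h1, h3 0, h4 0, h5 0, h2, fun i => h3 (i + 1), fun i => h4 (i + 1),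
        fun i => h5 (i + 1)⟩

theorem length_getD_succ_le {α : Type*} {μ : YoungDiagram} {F : List (List α)} (h : HasShape μ F)
    (i : ℕ) : (F.getD (i + 1) []).length ≤ (F.getD i []).length := by
  rw [(hasShape_iff.1 h).2, (hasShape_iff.1 h).2]
  exact μ.rowLen_anti _ _ (Nat.le_succ i)

theorem overRow_map_boxMin_iff {R S : List (Finset ℕ)} (hS : ∀ B ∈ S, B.Nonempty) :
    OverRow R (S.map boxMin) ↔ Over (fun A B => ∀ x ∈ A, ∀ y ∈ B, x < y) R S := by
  rw [OverRow, over_map_right]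
  constructor
  · exact fun h => h.imp fun A _ B _ hAB x hx y hy => lt_of_lt_of_le (hAB x hx) (boxMin_le hy)
  · exact fun h => h.imp fun A _ B hB hAB x hx => hAB x hx _ (boxMin_mem (hS B hB))

theorem mem_S_iff {lam : YoungDiagram} {F : List (List (Finset ℕ))} :
    F ∈ S lam ↔ SV F ∧ HasShape lam F := by
  constructor
  · intro (h : IsSetValuedTableau lam F)
    have hmem {i j : ℕ} : j < (F.getD i []).length → (i, j) ∈ lam := h.shape.mem_iff.2
    have hrow (i : ℕ) : RowOK (F.getD i []) := by
      refine ⟨?_, ?_, ?_⟩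
      · rw [forall_mem_iff_getD ∅]
        exact fun j hj => h.nonempty i j (hmem hj)
      · rw [forall_mem_iff_getD ∅ (P := fun B => ∀ x ∈ B, 0 < x)]
        exact fun j _ => h.pos i j
      · rw [pairwise_iff_getD ∅]
        exact fun j₁ j₂ hj hj₂ => h.row_weak i j₁ j₂ hj (hmem hj₂)
    refine ⟨sv_iff.2 ⟨(hasShape_iff.1 h.shape).1, hrow, fun i => ?_⟩, h.shape⟩
    rw [overRow_map_boxMin_iff (hrow _).nonempty, over_iff ∅ ∅]
    exact ⟨length_getD_succ_le h.shape i,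
      fun j hj => h.col_strict i (i + 1) j (Nat.lt_succ_self i) (hmem hj)⟩
  · rintro ⟨h, hs⟩
    obtain ⟨-, hrow, hcol⟩ := sv_iff.1 h
    have hne (i j : ℕ) (hij : (i, j) ∈ lam) : (entry ∅ F i j).Nonempty :=
      (forall_mem_iff_getD ∅).1 (hrow i).nonempty j (hs.mem_iff.1 hij)
    refine (⟨hs, hne, fun i j => ?_, fun i j₁ j₂ hj hj₂ => ?_, fun i₁ i₂ j hi hj => ?_⟩ :
      IsSetValuedTableau lam F)
    · rcases lt_or_ge j (F.getD i []).length with hj | hj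
      · exact (forall_mem_iff_getD ∅ (P := fun B => ∀ x ∈ B, 0 < x)).1 (hrow i).pos j hj
      · rw [entry, List.getD_eq_default _ _ hj]
        simp
    · exact (pairwise_iff_getD ∅).1 (hrow i).weak j₁ j₂ hj (hs.mem_iff.1 hj₂)
    · refine column_induction
        (P := fun a b => ∀ x ∈ entry ∅ F a j, ∀ y ∈ entry ∅ F b j, x < y)
        (fun i hij => ?_) (fun a b hb h1 h2 x hx y hy => ?_) hi hj
      · have := hcol i
        rw [overRow_map_boxMin_iff (hrow _).nonempty, over_iff ∅ ∅] at this
        exact this.2 j (hs.mem_iff.1 hij)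
      -- Comparison of boxes is transitive only through a nonempty box in between.
      · obtain ⟨z, hz⟩ := hne b j hb
        exact (h1 x hx z hz).trans (h2 z hz y hy)

theorem isSemistandard_iff {μ : YoungDiagram} {U : List (List ℕ)} :
    IsSemistandard μ U ↔ Tab U ∧ HasShape μ U := by
  constructor
  · intro h
    have hmem {i j : ℕ} : j < (U.getD i []).length → (i, j) ∈ μ := h.shape.mem_iff.2
    obtain ⟨V, hV⟩ := h.semistandard
    refine ⟨tab_iff.2 ⟨(hasShape_iff.1 h.shape).1, fun i => ?_, fun i => ?_, fun i => ?_⟩, h.shape⟩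
    · rw [pairwise_iff_getD 0]
      intro j₁ j₂ hj hj₂
      have := V.row_weak hj (hmem hj₂)
      rwa [hV, hV] at this
    · rw [forall_mem_iff_getD 0]
      exact fun j hj => h.pos i j (hmem hj)
    · rw [over_iff 0 0]
      refine ⟨length_getD_succ_le h.shape i, fun j hj => ?_⟩
      have := V.col_strict (Nat.lt_succ_self i) (hmem hj)
      rwa [hV, hV] at this
  · rintro ⟨h, hs⟩
    obtain ⟨-, hrow, hpos, hcol⟩ := tab_iff.1 h
    refine ⟨hs, fun i j hij => ?_, ⟨⟨entry 0 U, ?_, ?_, ?_⟩, fun _ _ => rfl⟩⟩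
    · exact (forall_mem_iff_getD 0).1 (hpos i) j (hs.mem_iff.1 hij)
    · exact fun {i j₁ j₂} hj hj₂ => (pairwise_iff_getD 0).1 (hrow i) j₁ j₂ hj (hs.mem_iff.1 hj₂)
    · intro i₁ i₂ j hi hj
      refine column_induction (P := fun a b => entry 0 U a j < entry 0 U b j)
        (fun i hij => ?_) (fun a b _ h1 h2 => h1.trans h2) hi hj
      exact ((over_iff 0 0).1 (hcol i)).2 j (hs.mem_iff.1 hij)
    · intro i j hij
      rw [hs.mem_iff, not_lt] at hij
      exact List.getD_eq_default _ _ hij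

/-- The relation forces the zeros of a row to form an initial segment. -/
theorem getD_eq_zero_iff_lt_count {l : List ℕ}
    (h : l.Pairwise fun a b => a = 0 ∧ b = 0 ∨ a < b) {j : ℕ} (hj : j < l.length) :
    l.getD j 0 = 0 ↔ j < l.count 0 := by
  induction l generalizing j with
  | nil => simp at hj
  | cons a l ih =>
    rw [List.pairwise_cons] at h
    rcases Nat.eq_zero_or_pos a with rfl | ha
    · cases j with
      | zero => simp
      | succ j =>
        rw [List.getD_cons_succ, ih h.2 (Nat.lt_of_succ_lt_succ hj), List.count_cons_self]
        omega
    · have hpos : ∀ x ∈ a :: l, x ≠ 0 := by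
        intro x hx
        rcases List.mem_cons.1 hx with rfl | hx
        · omega
        · have := h.1 x hx
          omega
      rw [List.count_eq_zero_of_not_mem fun h0 => hpos 0 h0 rfl]
      simpa using (forall_mem_iff_getD 0).1 hpos j hj

theorem isStrictSkew_iff {lam μ : YoungDiagram} {T : List (List ℕ)} :
    IsStrictSkew lam μ T ↔
      HasShape μ T ∧ TFill 0 T ∧ ∀ i, (T.getD i []).count 0 = lam.rowLen i := by
  constructor
  · intro h
    have hmem {i j : ℕ} : j < (T.getD i []).length → (i, j) ∈ μ := h.shape.mem_iff.2
    have hrow (i : ℕ) : (T.getD i []).Pairwise fun a b => a = 0 ∧ b = 0 ∨ a < b := by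
      rw [pairwise_iff_getD 0]
      intro j₁ j₂ hj hj₂
      by_cases h1 : (i, j₁) ∈ lam
      · have e1 := h.unfilled i j₁ h1
        by_cases h2 : (i, j₂) ∈ lam
        · exact Or.inl ⟨e1, h.unfilled i j₂ h2⟩
        · have e2 := (h.range i j₂ (hmem hj₂) h2).1
          rw [entry] at e1 e2
          exact Or.inr (by omega)
      · exact Or.inr (h.row_strict i j₁ j₂ hj h1 (hmem hj₂))
    refine ⟨h.shape, ⟨(hasShape_iff.1 h.shape).1, hrow, fun i => ?_, fun i => ?_⟩, fun i => ?_⟩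
    · rw [forall_mem_iff_getD 0]
      intro j hj
      by_cases h1 : (i, j) ∈ lam
      · exact (h.unfilled i j h1).trans_le (Nat.zero_le _)
      · exact (h.range i j (hmem hj) h1).2
    · rw [over_iff 0 0]
      refine ⟨length_getD_succ_le h.shape i, fun j hj => ?_⟩
      by_cases h1 : (i, j) ∈ lam
      · exact Or.inl (h.unfilled i j h1)
      · exact Or.inr (h.col_strict i (i + 1) j (Nat.lt_succ_self i) h1 (hmem hj))
    · have key (j : ℕ) (hj : j < (T.getD i []).length) :
          j < (T.getD i []).count 0 ↔ j < lam.rowLen i := by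
        rw [← getD_eq_zero_iff_lt_count (hrow i) hj, ← YoungDiagram.mem_iff_lt_rowLen]
        refine ⟨fun h0 => ?_, h.unfilled i j⟩
        by_contra hn
        have := (h.range i j (hmem hj) hn).1
        rw [entry] at this
        omega
      have hle : (T.getD i []).count 0 ≤ (T.getD i []).length := List.count_le_length
      have hle' : lam.rowLen i ≤ (T.getD i []).length := by
        by_contra hn
        exact absurd (h.shape.mem_iff.1 (h.le (YoungDiagram.mem_iff_lt_rowLen.2 (not_le.1 hn))))
          (lt_irrefl _)
      -- `key` is valid only inside the row. Both numbers are at most its length, so if they differ,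
      -- `key` applies at the smaller one.
      rcases lt_trichotomy ((T.getD i []).count 0) (lam.rowLen i) with hlt | heq | hlt
      · exact absurd ((key _ (hlt.trans_le hle')).2 hlt) (lt_irrefl _)
      · exact heq
      · exact absurd ((key _ (hlt.trans_le hle)).1 hlt) (lt_irrefl _)
  · rintro ⟨hs, h, hc⟩
    have hlam (i j : ℕ) (hj : j < (T.getD i []).length) :
        (i, j) ∈ lam ↔ entry 0 T i j = 0 := by
      rw [YoungDiagram.mem_iff_lt_rowLen, ← hc, ← getD_eq_zero_iff_lt_count (h.row i) hj, entry]
    have hle : lam ≤ μ := by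
      rintro ⟨i, j⟩ hij
      have hij' : j < lam.rowLen i := YoungDiagram.mem_iff_lt_rowLen.1 hij
      rw [← hc] at hij'
      exact hs.mem_iff.2 (hij'.trans_le List.count_le_length)
    refine ⟨hle, hs, fun i j hij => ?_, fun i j hij hn => ?_, fun i j₁ j₂ hj h1 h2 => ?_,
      fun i₁ i₂ j hi h1 h2 => ?_⟩
    · exact (hlam i j (hs.mem_iff.1 (hle hij))).1 hij
    · rw [hs.mem_iff] at hij
      rw [hlam i j hij] at hn
      exact ⟨Nat.pos_of_ne_zero hn, (forall_mem_iff_getD 0).1 (h.le i) j hij⟩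
    · rw [hs.mem_iff] at h2
      rw [hlam i j₁ (hj.trans h2)] at h1
      rcases (pairwise_iff_getD 0).1 (h.row i) j₁ j₂ hj h2 with h' | h'
      exacts [absurd h'.1 h1, h']
    · have h3 : (i₁, j) ∈ μ := μ.up_left_mem hi.le le_rfl h2
      rw [hlam i₁ j (hs.mem_iff.1 h3)] at h1
      refine Or.resolve_left (column_induction
        (P := fun a b => entry 0 T a j = 0 ∨ entry 0 T a j < entry 0 T b j)
        (fun i hij => ?_) (fun a b _ h1 h2 => by omega) hi h2) h1
      exact ((over_iff 0 0).1 (h.col i)).2 j (hs.mem_iff.1 hij)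

/-- Supplies the outer shape `μ`, which is only asserted to exist in `L lam`. -/
theorem Tab.exists_hasShape {U : List (List ℕ)} (h : Tab U) : ∃ μ, HasShape μ U := by
  have hanti : Antitone fun i => (U.getD i []).length :=
    antitone_nat_of_succ_le (h.length_getD_succ_le rfl)
  have hs : (U.map List.length).SortedGE := by
    refine List.Pairwise.sortedGE ?_
    rw [List.pairwise_map, pairwise_iff_getD []]
    exact fun i j hij _ => hanti hij.le
  refine ⟨YoungDiagram.ofRowLens _ hs, ?_⟩
  refine (YoungDiagram.rowLens_ofRowLens_eq_self fun x hx => ?_).symm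
  obtain ⟨R, hR, rfl⟩ := List.mem_map.1 hx
  rw [List.length_pos_iff]
  rintro rfl
  exact h.nil_notMem hR

theorem hasShape_congr {α β : Type*} {μ : YoungDiagram} {T : List (List α)} {U : List (List β)}
    (h : T.map List.length = U.map List.length) : HasShape μ T ↔ HasShape μ U := by
  rw [HasShape, HasShape, h]

theorem mem_L_iff {lam : YoungDiagram} {p : List (List ℕ) × List (List ℕ)} :
    p ∈ L lam ↔ LPair p ∧ ∀ i, (p.1.getD i []).count 0 = lam.rowLen i := by
  constructor
  · rintro ⟨μ, h1, h2⟩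
    rw [isStrictSkew_iff] at h1
    rw [isSemistandard_iff] at h2
    exact ⟨⟨h2.1, h1.2.1, Eq.trans h1.1 h2.2.symm⟩, h1.2.2⟩
  · rintro ⟨⟨h1, h2, h3⟩, h4⟩
    obtain ⟨μ, hμ⟩ := h1.exists_hasShape
    exact ⟨μ, isStrictSkew_iff.2 ⟨(hasShape_congr h3).2 hμ, h2, h4⟩,
      isSemistandard_iff.2 ⟨h1, hμ⟩⟩

theorem card_cellsOfRowLens (w : List ℕ) : (YoungDiagram.cellsOfRowLens w).card = w.sum := by
  induction w with
  | nil => rfl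
  | cons a w ih =>
    rw [YoungDiagram.cellsOfRowLens, Finset.card_union_of_disjoint, Finset.card_map, ih]
    · simp
    · rw [Finset.disjoint_left]
      rintro ⟨i, j⟩ h1 h2
      simp only [Finset.mem_product, Finset.mem_singleton] at h1
      obtain ⟨⟨a, b⟩, -, h⟩ := Finset.mem_map.1 h2
      simp only [Function.Embedding.prodMap, Function.Embedding.coeFn_mk, Prod.map_apply,
        Prod.mk.injEq] at h
      omega

theorem card_eq_sum_rowLens (μ : YoungDiagram) : μ.card = μ.rowLens.sum := by
  rw [← card_cellsOfRowLens]
  exact congrArg YoungDiagram.card (YoungDiagram.ofRowLens_to_rowLens_eq_self (μ := μ)).symm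

/-! ### The two maps between `S lam` and `L lam`. -/

theorem mapsTo_uncrowd (lam : YoungDiagram) : Set.MapsTo uncrowd (S lam) (L lam) := by
  intro F hF
  rw [mem_S_iff] at hF
  exact mem_L_iff.2 ⟨(uncrowd_spec hF.1).1, fun i => by
    rw [count_zero_uncrowd, (hasShape_iff.1 hF.2).2]⟩

theorem mapsTo_crowd (lam : YoungDiagram) : Set.MapsTo crowd (L lam) (S lam) := by
  intro p hp
  rw [mem_L_iff] at hp
  obtain ⟨h1, h2⟩ := crowdRows_spec hp.1 le_rfl
  refine mem_S_iff.2 ⟨h1, hasShape_iff.2 ⟨(sv_iff.1 h1).1, fun i => ?_⟩⟩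
  -- The row lengths of the crowded tableau are the zero counts of its image under `uncrowd`, which
  -- is `p` again.
  rw [← hp.2, crowd, ← count_zero_uncrowd, h2]

theorem invOn_crowd_uncrowd (lam : YoungDiagram) : Set.InvOn crowd uncrowd (S lam) (L lam) :=
  ⟨fun _ hF => (uncrowd_spec (mem_S_iff.1 hF).1).2 _ le_rfl,
    fun _ hp => (crowdRows_spec (mem_L_iff.1 hp).1 le_rfl).2⟩

end Crowding

theorem mainTheorem3 (lam : YoungDiagram) :
    Set.BijOn Crowding.uncrowd (Crowding.S lam) (Crowding.L lam) ∧
    Set.BijOn Crowding.crowd (Crowding.L lam) (Crowding.S lam) ∧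
    Set.InvOn Crowding.crowd Crowding.uncrowd (Crowding.S lam) (Crowding.L lam) ∧
    ∀ F ∈ Crowding.S lam,
      (∀ v : ℕ, Crowding.weight (Crowding.uncrowd F).2 v = Crowding.setWeight F v) ∧
      Crowding.skewSize (Crowding.uncrowd F).1 + lam.card = Crowding.setSize F := by
  have hinv := Crowding.invOn_crowd_uncrowd lam
  have h1 := Crowding.mapsTo_uncrowd lam
  have h2 := Crowding.mapsTo_crowd lam
  refine ⟨hinv.bijOn h1 h2, hinv.symm.bijOn h2 h1, hinv, fun F hF => ?_⟩
  rw [Crowding.mem_S_iff] at hF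
  refine ⟨fun v => Crowding.weight_uncrowd v hF.1, ?_⟩
  rw [Crowding.card_eq_sum_rowLens, ← show F.map List.length = lam.rowLens from hF.2]
  exact Crowding.skewSize_uncrowd hF.1
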